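/- Let $0<d<k$ be integers. For a real $(k-d)\times d$ matrix $(\alpha_{ij})$ let $L:\mathbb{R}^d\to\mathbb{R}^{k-d}$, $L(x)_i=\sum_j\alpha_{ij}x_j$, be the corresponding linear map and $E=\{(x,L(x))\mid x\in\mathbb{R}^d\}\subset\mathbb{R}^k$ its graph. Let $F_\pi\subset\mathbb{R}^k$ be a linear subspace complementary to $E$, and let $\pi$ and $\pi^*$ be the projections onto $E$ and $F_\pi$ given by $\mathbb{R}^k=E+F_\pi$; assume that $\pi$ is injective on $\mathbb{Z}^k$. Put $\mathcal{W}_\pi=\pi^*(\{0\}^d\times[0,1]^{k-d})$ and $\mathcal{S}=\mathcal{W}_\pi+E$. For $s\in\mathbb{R}^k$ the cubical cut and project set is $Y_s=\pi(\mathcal{S}\cap(\mathbb{Z}^k+s))$; it is regular if $\partial\mathcal{S}\cap(\mathbb{Z}^k+s)=\emptyset$. For $y\in Y_s$ let $\tilde y$ be the unique point of $\mathbb{Z}^k+s$ with $\pi(\tilde y)=y$. For $r\ge 0$ let $C(r)$ be the set of points of $\mathbb{Z}^k$ whose first $d$ coordinates lie in $[-r,r]$, and let $P(y,r)=\{y'\in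 Y_s\mid \tilde y'-\tilde y\in C(r)\}$. Two patches $P(y_1,r)$ and $P(y_2,r)$ are equivalent if $P(y_1,r)-y_1=P(y_2,r)-y_2$. For a function $\phi$ of $r$, the set $Y_s$ is $\phi$-repulsive if for all sufficiently large $r$ any two distinct points $y,y'\in Y_s$ with equivalent $r$-patches satisfy $d(y,y')>\phi(r)$, where $d(\cdot,\cdot)$ is the Euclidean distance. Fix $c,\epsilon>0$. Then for Lebesgue almost every $L$ (that is, almost every $(\alpha_{ij})\in\mathbb{R}^{d(k-d)}$), for every such $F_\pi$ and every $s\in\mathbb{R}^k$ for which $Y_s$ is regular: (i) $Y_s$ is not $\phi$-repulsive for any $\phi$ with $\phi(r)\ge \dfrac{c\,r^{k-d}}{(\log r)^{1/d}}$ for all sufficiently large $r$; (ii) $Y_s$ is $\phi$-repulsive for every $\phi$ with $\phi(r)\le \dfrac{c\,r^{k-d}}{(\log r)^{(1/d)+k-d+\epsilon}}$ for all sufficiently large $r$. -/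

import Mathlib

open Filter
open scoped Pointwise

noncomputable section

namespace CutProject

variable {d m : ℕ}

/-- The total space `ℝ^k`, `k = d + m`, with its Euclidean norm. The first `d` coordinates are
indexed by `Sum.inl`, the last `m = k - d` by `Sum.inr`. -/
abbrev TotalSpace (d m : ℕ) : Type := EuclideanSpace ℝ (Fin d ⊕ Fin m)

/-- The physical space `E = {(x, L x) | x ∈ ℝ^d}`, the graph of the linear map
`L : ℝ^d → ℝ^m` with `L_i x = ∑ j, α i j * x j`. -/
def physicalSpace (α : Fin m → Fin d → ℝ) : Submodule ℝ (TotalSpace d m) where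
  carrier := {v | ∀ i : Fin m, v (Sum.inr i) = ∑ j : Fin d, α i j * v (Sum.inl j)}
  add_mem' := by
    intro a b ha hb i
    simp [ha i, hb i, mul_add, Finset.sum_add_distrib]
  zero_mem' := by
    intro i
    simp
  smul_mem' := by
    intro t a ha i
    simp [ha i, Finset.mul_sum, mul_left_comm]

/-- The integer lattice `ℤ^k` in the total space. -/
def integerLattice (d m : ℕ) : Set (TotalSpace d m) :=
  {v | ∀ i, ∃ n : ℤ, v i = n}

/-- The translated lattice `ℤ^k + s`. -/
def shiftedLattice (s : TotalSpace d m) : Set (TotalSpace d m) :=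
  {x | ∃ z ∈ integerLattice d m, x = z + s}

/-- The unit cube `{0}^d × [0,1]^m`, a face of the unit cube of the total space. -/
def unitFace (d m : ℕ) : Set (TotalSpace d m) :=
  {v | (∀ j : Fin d, v (Sum.inl j) = 0) ∧ ∀ i : Fin m, v (Sum.inr i) ∈ Set.Icc (0 : ℝ) 1}

/-- The cylinder `C(r)` of the lattice points whose first `d` coordinates lie in `[-r, r]^d`. -/
def cylinder (d m : ℕ) (r : ℝ) : Set (TotalSpace d m) :=
  {v | v ∈ integerLattice d m ∧ ∀ j : Fin d, v (Sum.inl j) ∈ Set.Icc (-r) r}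

/-- The data of a cubical cut and project scheme with physical space the graph of `α`: an internal
space `F` complementary to `E`, such that the projection onto `E` along `F` is injective on the
integer lattice. -/
structure CubicalScheme (α : Fin m → Fin d → ℝ) where
  /-- The internal space. -/
  internal : Submodule ℝ (TotalSpace d m)
  isCompl : IsCompl (physicalSpace α) internal
  injOn : Set.InjOn ((physicalSpace α).projection internal isCompl) (integerLattice d m)

namespace CubicalScheme

variable {α : Fin m → Fin d → ℝ} (C : CubicalScheme α)

/-- The projection `π` onto the physical space along the internal space. -/
def proj : TotalSpace d m →ₗ[ℝ] TotalSpace d m :=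
  (physicalSpace α).projection C.internal C.isCompl

/-- The projection `π*` onto the internal space along the physical space. -/
def projStar : TotalSpace d m →ₗ[ℝ] TotalSpace d m :=
  C.internal.projection (physicalSpace α) C.isCompl.symm

/-- The cubical window in the internal space. -/
def window : Set (TotalSpace d m) := C.projStar '' unitFace d m

/-- The slice `𝒮`, the sum of the window and the physical space. -/
def slice : Set (TotalSpace d m) := C.window + (physicalSpace α : Set (TotalSpace d m))

/-- The cut and project set `Y_s = π(𝒮 ∩ (ℤ^k + s))`. -/
def cutProjectSet (s : TotalSpace d m) : Set (TotalSpace d m) :=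
  C.proj '' (C.slice ∩ shiftedLattice s)

/-- The parameter `s` (and `Y_s`) is regular if `∂𝒮 ∩ (ℤ^k + s) = ∅`. -/
def IsRegular (s : TotalSpace d m) : Prop :=
  frontier C.slice ∩ shiftedLattice s = ∅

/-- `x` is a lift of `y`: an element of `ℤ^k + s` with `π x = y`. -/
def IsLift (s x y : TotalSpace d m) : Prop := x ∈ shiftedLattice s ∧ C.proj x = y

/-- Every point of `Y_s` has exactly one lift. -/
theorem existsUnique_isLift {s y : TotalSpace d m} (hy : y ∈ C.cutProjectSet s) :
    ∃! x, C.IsLift s x y := by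
  obtain ⟨x, ⟨-, hx⟩, rfl⟩ := hy
  refine ⟨x, ⟨hx, rfl⟩, ?_⟩
  rintro x' ⟨⟨z', hz', rfl⟩, h⟩
  obtain ⟨z, hz, rfl⟩ := hx
  have h' : C.proj z' = C.proj z := by simpa using h
  rw [C.injOn hz' hz h']

/-- The `r`-patch `P(y, r)`: the points `y'` of `Y_s` whose lift differs from the lift of `y` by an
element of `C(r)`. -/
def patch (s y : TotalSpace d m) (r : ℝ) : Set (TotalSpace d m) :=
  {y' | y' ∈ C.cutProjectSet s ∧
    ∃ x x', C.IsLift s x y ∧ C.IsLift s x' y' ∧ x' - x ∈ cylinder d m r}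

/-- Equivalence of the `r`-patches at `y₁` and `y₂`: `P(y₁, r) - y₁ = P(y₂, r) - y₂`. -/
def PatchEquiv (s : TotalSpace d m) (r : ℝ) (y₁ y₂ : TotalSpace d m) : Prop :=
  (fun z => z - y₁) '' C.patch s y₁ r = (fun z => z - y₂) '' C.patch s y₂ r

/-- `Y_s` is `φ`-repulsive: for all sufficiently large `r`, distinct points of `Y_s` with equivalent
`r`-patches are at distance greater than `φ r`. -/
def IsRepulsive (s : TotalSpace d m) (φ : ℝ → ℝ) : Prop :=
  ∀ᶠ r : ℝ in atTop, ∀ y ∈ C.cutProjectSet s, ∀ y' ∈ C.cutProjectSet s,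
    y ≠ y' → C.PatchEquiv s r y y' → φ r < dist y y'

end CubicalScheme

end CutProject

end

/-! Write m = k - d and let w denote the coordinates modulo E (`transverse`). The slice is the set
where w lies in [0,1]^m. For regular s it therefore contains exactly one point of ℤ^k + s over each
n in ℤ^d, and w(n + h) is w(n) - L(h) brought back into (0,1)^m by an integer vector. So the
r-patches at n and n' agree exactly when no value L_i(h) mod 1 with |h| ≤ r separates w_i(n) from
w_i(n'). The internal space only affects constants in the distances, and repulsivity becomes a
question about how small L(q) mod 1 can be for q = n' - n.

(i) The roughly r^d values of each L_i leave a gap of length at least g / r^d (`exists_gap`).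
Suppose q ≠ 0 has size at most c₀ r^m / (log r)^(1/d) and every L_i(q) is within c₀ / r^d of an
integer, with c₀ < g. Density of the values L(n) mod 1 then places both w(n) and w(n + q) in the
product of the gaps, which gives two close points with equal patches. Almost every L has such q for
arbitrarily large r and every c₀: this is the divergence part of Khinchin–Groshev, with critical sum
∑ 1/j over exponential scales. Positive measure comes from a second-moment inequality for
quasi-independent events: primitive vectors when d ≥ 2, neighbourhoods of reduced fractions when d =
1. The bound does not depend on c₀, and the systems good for every c₀ are invariant under the dense
group of torsion translations, so they have full measure.

(ii) For almost every L, the values L_i(h) with |h| < 2^j leave no gap much longer than δ = j^(1+ε')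
/ 2^(jd). This is a second-moment bound followed by Borel–Cantelli. Equal patches then force every
L_i(q) to within 2δ of an integer, while the convergence part of Khinchin–Groshev forbids even 3δ
for all nonzero q in the required range. -/

open MeasureTheory

/-! ### A second-moment lower bound for the measure of a union -/

theorem MeasureTheory.div_le_measureReal_biUnion {Ω ι : Type*} [MeasurableSpace Ω] (μ : Measure Ω)
    [IsProbabilityMeasure μ] (S : Finset ι) (F : ι → Set Ω) (hF : ∀ a ∈ S, MeasurableSet (F a))
    {K : ℝ} (hK : 0 ≤ K)
    (hpair : ∀ a ∈ S, ∀ b ∈ S, a ≠ b → μ.real (F a ∩ F b) ≤ K * μ.real (F a) * μ.real (F b)) :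
    (∑ a ∈ S, μ.real (F a)) / (1 + K * ∑ a ∈ S, μ.real (F a)) ≤ μ.real (⋃ a ∈ S, F a) := by
  classical
  set M := ∑ a ∈ S, μ.real (F a) with hM
  set U := ⋃ a ∈ S, F a with hU
  have hMn : 0 ≤ M := Finset.sum_nonneg fun a _ => measureReal_nonneg
  have hUm : MeasurableSet U := Finset.measurableSet_biUnion S hF
  set Z : Ω → ℝ := fun x => ∑ a ∈ S, (F a).indicator 1 x with hZ
  -- With Z the number of events that occur, Z vanishes off U and ∫ Z² ≤ M + K M² = t M. Expanding ∫
  -- (Z - t 1_U)² ≥ 0 then gives t M - 2 t M + t² μ(U) ≥ 0, which is the claim.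
  set t := 1 + K * M with ht
  have htpos : 0 < t := by positivity
  have hZU : ∀ x, Z x * U.indicator 1 x = Z x := by
    intro x
    by_cases hx : x ∈ U
    · simp [hx]
    · have : Z x = 0 := Finset.sum_eq_zero fun a ha => by
        have : x ∉ F a := fun h => hx (Set.mem_biUnion ha h)
        simp [this]
      simp [this]
  have hU2 : ∀ x, (U.indicator 1 x : ℝ) * U.indicator 1 x = U.indicator 1 x := by
    intro x
    by_cases hx : x ∈ U <;> simp [hx]
  have hexp : ∀ x, (Z x - t * U.indicator 1 x) ^ 2
      = (∑ a ∈ S, ∑ b ∈ S, (F a ∩ F b).indicator (1 : Ω → ℝ) x)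
        + ((- 2 * t) * ∑ a ∈ S, (F a).indicator (1 : Ω → ℝ) x
          + t ^ 2 * U.indicator (1 : Ω → ℝ) x) := by
    intro x
    have h1 : (∑ a ∈ S, ∑ b ∈ S, (F a ∩ F b).indicator (1 : Ω → ℝ) x) = Z x * Z x := by
      simp only [hZ, Finset.sum_mul_sum, Set.inter_indicator_one, Pi.mul_apply]
    rw [h1]
    linear_combination (-2 * t) * hZU x + t ^ 2 * hU2 x
  have hint : ∀ A : Set Ω, MeasurableSet A → Integrable (A.indicator (1 : Ω → ℝ)) μ :=
    fun A hA => (integrable_const (1 : ℝ)).indicator hA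
  have i1 : Integrable (fun x => ∑ a ∈ S, ∑ b ∈ S, (F a ∩ F b).indicator (1 : Ω → ℝ) x) μ :=
    integrable_finsetSum _ fun a ha => integrable_finsetSum _ fun b hb =>
      hint _ ((hF a ha).inter (hF b hb))
  have i2 : Integrable (fun x => ∑ a ∈ S, (F a).indicator (1 : Ω → ℝ) x) μ :=
    integrable_finsetSum _ fun a ha => hint _ (hF a ha)
  have i3 : Integrable (fun x => (-2 * t) * ∑ a ∈ S, (F a).indicator (1 : Ω → ℝ) x
      + t ^ 2 * U.indicator (1 : Ω → ℝ) x) μ :=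
    (i2.const_mul _).add ((hint U hUm).const_mul _)
  have hnn : 0 ≤ ∫ x, (Z x - t * U.indicator 1 x) ^ 2 ∂μ := integral_nonneg fun x => sq_nonneg _
  simp_rw [hexp] at hnn
  rw [integral_add i1 i3,
    integral_add (i2.const_mul _) ((hint U hUm).const_mul _), integral_const_mul,
    integral_const_mul, integral_finsetSum _ (fun a ha => hint _ (hF a ha)),
    integral_finsetSum _ (fun a ha => integrable_finsetSum _ fun b hb =>
      hint _ ((hF a ha).inter (hF b hb))), integral_indicator_one hUm] at hnn
  have e2 : ∑ a ∈ S, ∫ x, (F a).indicator (1 : Ω → ℝ) x ∂μ = M :=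
    Finset.sum_congr rfl fun a ha => integral_indicator_one (hF a ha)
  have e1 : ∑ a ∈ S, ∫ x, ∑ b ∈ S, (F a ∩ F b).indicator (1 : Ω → ℝ) x ∂μ ≤ M + K * M ^ 2 := by
    have : ∀ a ∈ S, ∫ x, ∑ b ∈ S, (F a ∩ F b).indicator (1 : Ω → ℝ) x ∂μ
        ≤ μ.real (F a) + K * μ.real (F a) * M := by
      intro a ha
      rw [integral_finsetSum _ (fun b hb => hint _ ((hF a ha).inter (hF b hb)))]
      have : ∀ b ∈ S, ∫ x, (F a ∩ F b).indicator (1 : Ω → ℝ) x ∂μ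
          ≤ (if a = b then μ.real (F a) else 0) + K * μ.real (F a) * μ.real (F b) := by
        intro b hb
        rw [integral_indicator_one ((hF a ha).inter (hF b hb))]
        split_ifs with hab
        · subst hab
          rw [Set.inter_self]
          have : 0 ≤ K * μ.real (F a) * μ.real (F a) := by positivity
          linarith
        · simpa using hpair a ha b hb hab
      refine (Finset.sum_le_sum this).trans ?_
      rw [Finset.sum_add_distrib, ← Finset.mul_sum, Finset.sum_ite_eq, if_pos ha]
    refine (Finset.sum_le_sum this).trans ?_
    rw [Finset.sum_add_distrib, ← Finset.sum_mul, ← Finset.mul_sum]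
    exact le_of_eq (by ring)
  rw [e2] at hnn
  rw [div_le_iff₀ htpos]
  have : 0 ≤ t * (μ.real U * t - M) := by
    have h3 : M + K * M ^ 2 = t * M := by rw [ht]; ring
    nlinarith
  have := nonneg_of_mul_nonneg_right this htpos
  linarith

/-! ### Haar measure on tori and linear forms modulo one -/

instance UnitAddCircle.isProbabilityMeasure :
    IsProbabilityMeasure (volume : Measure UnitAddCircle) := ⟨by simp⟩

namespace UnitAddCircle

variable {m n : ℕ}

instance secondCountableTopology_pi : SecondCountableTopology (Fin n → UnitAddCircle) :=
  TopologicalSpace.instSecondCountableTopologyForallOfCountable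

instance secondCountableTopology_pi_pi :
    SecondCountableTopology (Fin m → Fin n → UnitAddCircle) :=
  TopologicalSpace.instSecondCountableTopologyForallOfCountable

instance borelSpace_pi : BorelSpace (Fin n → UnitAddCircle) := Pi.borelSpace

instance borelSpace_pi_pi : BorelSpace (Fin m → Fin n → UnitAddCircle) := Pi.borelSpace

instance borelSpace_pi_pi_prod :
    BorelSpace ((Fin m → Fin n → UnitAddCircle) × (Fin m → UnitAddCircle)) := Prod.borelSpace

instance borelSpace_pi_prod :
    BorelSpace ((Fin m → UnitAddCircle) × (Fin m → UnitAddCircle)) := Prod.borelSpace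

instance isAddHaarMeasure_pi :
    Measure.IsAddHaarMeasure (volume : Measure (Fin n → UnitAddCircle)) :=
  inferInstance

instance isAddHaarMeasure_pi_pi :
    Measure.IsAddHaarMeasure (volume : Measure (Fin m → Fin n → UnitAddCircle)) :=
  Measure.instIsAddHaarMeasureForallVolumeOfMeasurableAddOfSigmaFinite

instance isAddHaarMeasure_pi_pi_prod : Measure.IsAddHaarMeasure
    (volume : Measure ((Fin m → Fin n → UnitAddCircle) × (Fin m → UnitAddCircle))) :=
  Measure.prod.instIsAddHaarMeasure _ _

instance isAddHaarMeasure_pi_prod : Measure.IsAddHaarMeasure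
    (volume : Measure ((Fin m → UnitAddCircle) × (Fin m → UnitAddCircle))) :=
  Measure.prod.instIsAddHaarMeasure _ _

instance innerRegular_pi_pi :
    Measure.InnerRegular (volume : Measure (Fin m → Fin n → UnitAddCircle)) :=
  inferInstance

end UnitAddCircle

theorem UnitAddCircle.volume_real_ball (x : UnitAddCircle) {ψ : ℝ} (h0 : 0 ≤ ψ) :
    volume.real (Metric.ball x ψ) = min 1 (2 * ψ) := by
  rw [measureReal_def, ← measure_congr AddCircle.closedBall_ae_eq_ball, AddCircle.volume_closedBall,
    ENNReal.toReal_ofReal (by positivity)]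

namespace Torus

variable {m d : ℕ}

/-- The system of linear forms `q ↦ α q` with coefficients in the circle. -/
def linearForms (q : Fin d → ℤ) : (Fin m → Fin d → UnitAddCircle) →+ (Fin m → UnitAddCircle) :=
  AddMonoidHom.mk' (fun α i => ∑ j, q j • α i j) fun α β => by
    ext i
    simp [Finset.sum_add_distrib]

theorem linearForms_apply (q : Fin d → ℤ) (α : Fin m → Fin d → UnitAddCircle) (i : Fin m) :
    linearForms q α i = ∑ j, q j • α i j := rfl

theorem continuous_linearForms (q : Fin d → ℤ) :
    Continuous (linearForms q : (Fin m → Fin d → UnitAddCircle) → _) := by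
  refine continuous_pi fun i => ?_
  simp only [linearForms_apply]
  fun_prop

theorem linearForms_sub (q q' : Fin d → ℤ) (α : Fin m → Fin d → UnitAddCircle) :
    linearForms (q - q') α = linearForms q α - linearForms q' α := by
  ext i
  simp [linearForms_apply, sub_smul, Finset.sum_sub_distrib]

theorem exists_zsmul_eq {n : ℤ} (hn : n ≠ 0) (x : UnitAddCircle) : ∃ y, n • y = x :=
  ⟨DivisibleBy.div x n, DivisibleBy.div_cancel x hn⟩

/-- The circle is divisible, so a single nonzero coefficient suffices to solve for the corresponding
column. -/
theorem surjective_linearForms {q : Fin d → ℤ} (hq : q ≠ 0) :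
    Function.Surjective (linearForms q : (Fin m → Fin d → UnitAddCircle) → _) := by
  obtain ⟨j, hj⟩ := Function.ne_iff.1 hq
  intro β
  choose γ hγ using fun i => exists_zsmul_eq hj (β i)
  refine ⟨fun i => Pi.single j (γ i), ?_⟩
  ext i
  rw [linearForms_apply, Finset.sum_eq_single j]
  · simpa using hγ i
  · intro b _ hb
    simp [hb]
  · simp

/-- A continuous surjective homomorphism of compact groups carries normalized Haar measure to
normalized Haar measure. All later independence statements are this fact for suitable homomorphisms.
-/
theorem measurePreserving_linearForms {q : Fin d → ℤ} (hq : q ≠ 0) :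
    MeasurePreserving (linearForms q : (Fin m → Fin d → UnitAddCircle) → _) :=
  AddMonoidHom.measurePreserving (continuous_linearForms q) (surjective_linearForms hq) (by simp)

/-- The open cube of radius `ψ` in the torus. -/
def cube (m : ℕ) (ψ : ℝ) : Set (Fin m → UnitAddCircle) := {β | ∀ i, ‖β i‖ < ψ}

theorem cube_eq_pi (ψ : ℝ) : cube m ψ = Set.univ.pi fun _ => Metric.ball 0 ψ := by
  ext β
  simp [cube]

theorem isOpen_cube (ψ : ℝ) : IsOpen (cube m ψ) := by
  rw [cube_eq_pi]
  exact isOpen_set_pi Set.finite_univ fun _ _ => Metric.isOpen_ball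

theorem volume_real_cube {ψ : ℝ} (h0 : 0 ≤ ψ) :
    volume.real (cube m ψ) = min 1 (2 * ψ) ^ m := by
  rw [cube_eq_pi, measureReal_def, volume_pi_pi, ENNReal.toReal_prod]
  simp_rw [← measureReal_def, UnitAddCircle.volume_real_ball 0 h0]
  simp

theorem volume_real_linearForms_preimage_cube {q : Fin d → ℤ} (hq : q ≠ 0) {ψ : ℝ} (h0 : 0 ≤ ψ) :
    volume.real ((linearForms q : (Fin m → Fin d → UnitAddCircle) → _) ⁻¹' cube m ψ)
      = min 1 (2 * ψ) ^ m := by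
  rw [measureReal_def, (measurePreserving_linearForms hq).measure_preimage
    (isOpen_cube ψ).measurableSet.nullMeasurableSet, ← measureReal_def, volume_real_cube h0]

end Torus

/-! ### A zero-one law for dense groups of translations -/

/-- Translations by a dense set act ergodically, so an invariant set is null or conull. This
upgrades positive measure to full measure. -/
theorem MeasureTheory.ae_mem_of_dense_stabilizer {G : Type*} [AddGroup G] [TopologicalSpace G]
    [IsTopologicalAddGroup G] [R1Space G] [MeasurableSpace G] [BorelSpace G] [MeasurableAdd₂ G]
    (μ : Measure G) [IsFiniteMeasure μ] [μ.InnerRegular] [μ.IsAddLeftInvariant] {s : Set G}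
    (hs : NullMeasurableSet s μ) (hd : Dense {g : G | ∀ x, g + x ∈ s ↔ x ∈ s}) (h0 : μ s ≠ 0) :
    ∀ᵐ x ∂μ, x ∈ s := by
  have := aeconst_of_dense_setOfPred_preimage_vadd_eq (M := G) (μ := μ) hs
    (hd.mono fun g (hg : ∀ x, g + x ∈ s ↔ x ∈ s) => Set.ext fun x => hg x)
  rcases eventuallyConst_set.1 this with h | h
  · exact h
  · exact absurd (measure_eq_zero_iff_ae_notMem.2 h) h0

/-! ### Covering the torus by values of linear forms -/

namespace Torus

variable {m d : ℕ}

/-- The map `(α, x) ↦ α q - x`. -/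
def affineForms (q : Fin d → ℤ) :
    (Fin m → Fin d → UnitAddCircle) × (Fin m → UnitAddCircle) →+ (Fin m → UnitAddCircle) :=
  (linearForms q).comp (AddMonoidHom.fst _ _) - AddMonoidHom.snd _ _

theorem affineForms_apply (q : Fin d → ℤ)
    (p : (Fin m → Fin d → UnitAddCircle) × (Fin m → UnitAddCircle)) :
    affineForms q p = linearForms q p.1 - p.2 := rfl

theorem continuous_affineForms (q : Fin d → ℤ) : Continuous (affineForms (m := m) q) :=
  ((continuous_linearForms q).comp continuous_fst).sub continuous_snd

theorem measurePreserving_affineForms (q : Fin d → ℤ) :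
    MeasurePreserving (affineForms (m := m) q) := by
  refine AddMonoidHom.measurePreserving (continuous_affineForms q) ?_ (by simp)
  intro β
  exact ⟨(0, -β), by simp [affineForms_apply]⟩

/-- The random shift x makes any two distinct q, q' independent, even parallel ones: a suitable α
realizes the difference u - v through q - q' ≠ 0, and x then adjusts the common part. -/
theorem measurePreserving_affineForms_prod {q q' : Fin d → ℤ} (h : q ≠ q') :
    MeasurePreserving ((affineForms (m := m) q).prod (affineForms q')) := by
  refine AddMonoidHom.measurePreserving
    ((continuous_affineForms q).prodMk (continuous_affineForms q')) ?_ (by simp)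
  rintro ⟨u, v⟩
  obtain ⟨α, hα⟩ := surjective_linearForms (m := m) (sub_ne_zero.2 h) (u - v)
  refine ⟨(α, linearForms q α - u), ?_⟩
  rw [linearForms_sub] at hα
  ext i
  · simp [affineForms_apply]
  · have := congrFun hα i
    simp only [Pi.sub_apply] at this
    simp only [AddMonoidHom.prod_apply, affineForms_apply, Pi.sub_apply]
    rw [sub_sub_eq_add_sub, add_comm, ← sub_sub_eq_add_sub, this]
    abel

theorem sub_mem_cube {β γ : Fin m → UnitAddCircle} {η : ℝ} (hβ : β ∈ cube m η)
    (hγ : γ ∈ cube m η) : β - γ ∈ cube m (2 * η) := fun i => by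
  have h1 := hβ i
  have h2 := hγ i
  have h3 := norm_sub_le (β i) (γ i)
  rw [Pi.sub_apply]
  linarith

/-- Outside a set of small measure, the linear forms take values close to every point at integer
points of bounded size. -/
theorem volume_not_covered_le {N : ℕ} (hN : 0 < N) {η : ℝ} (h0 : 0 < η) (h1 : 2 * η ≤ 1) :
    volume {α : Fin m → Fin d → UnitAddCircle | ∃ b, ∀ n : Fin d → ℤ, (∀ j, |n j| < N) →
      linearForms n α - b ∉ cube m (2 * η)} ≤ ENNReal.ofReal (2 / (N ^ d * (2 * η) ^ m)) := by
  classical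
  set S : Finset (Fin d → ℤ) := Fintype.piFinset fun _ => Finset.Ico 0 (N : ℤ) with hS
  have hScard : S.card = N ^ d := by simp [hS]
  set F : (Fin d → ℤ) → Set ((Fin m → Fin d → UnitAddCircle) × (Fin m → UnitAddCircle)) :=
    fun q => affineForms q ⁻¹' cube m η with hF
  have hopen : ∀ q, IsOpen (F q) := fun q => (isOpen_cube η).preimage (continuous_affineForms q)
  have hcube : volume.real (cube m η) = (2 * η) ^ m := by
    rw [volume_real_cube h0.le, min_eq_right h1]
  have hFvol : ∀ q, volume.real (F q) = (2 * η) ^ m := fun q => by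
    rw [← hcube, measureReal_def, measureReal_def]
    exact congrArg _ ((measurePreserving_affineForms q).measure_preimage
      (isOpen_cube η).measurableSet.nullMeasurableSet)
  have hpair : ∀ q q', q ≠ q' → volume.real (F q ∩ F q') = (2 * η) ^ m * (2 * η) ^ m := by
    intro q q' h
    rw [← hcube, measureReal_def, measureReal_def, ← ENNReal.toReal_mul, ← Measure.prod_prod,
      ← Measure.volume_eq_prod,
      ← (measurePreserving_affineForms_prod (m := m) h).measure_preimage
        ((isOpen_cube η).measurableSet.prod (isOpen_cube η).measurableSet).nullMeasurableSet]
    rfl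
  set M : ℝ := N ^ d * (2 * η) ^ m with hM
  have hMpos : 0 < M := by positivity
  have hsum : ∑ q ∈ S, volume.real (F q) = M := by
    simp [hFvol, hScard, hM]
  set U := ⋃ q ∈ S, F q with hU
  have hUm : MeasurableSet U := Finset.measurableSet_biUnion S fun q _ => (hopen q).measurableSet
  -- The events are pairwise independent, so the second-moment bound applies with K = 1.
  have hUle : volume.real Uᶜ ≤ 1 / M := by
    have := div_le_measureReal_biUnion volume S F (fun q _ => (hopen q).measurableSet) zero_le_one
      (fun a _ b _ hab => by rw [hpair a b hab, hFvol, hFvol, one_mul])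
    rw [hsum, one_mul, ← hU] at this
    rw [measureReal_compl hUm, probReal_univ]
    have h3 : 1 - M / (1 + M) ≤ 1 / M := by
      rw [one_sub_div (by positivity), add_sub_cancel_right]
      exact one_div_le_one_div_of_le hMpos (by linarith)
    linarith
  set g : (Fin m → Fin d → UnitAddCircle) → ENNReal := fun α => volume (Prod.mk α ⁻¹' Uᶜ) with hg
  have hint : ∫⁻ α, g α = volume Uᶜ := by
    rw [Measure.volume_eq_prod, Measure.prod_apply hUm.compl]
  have hmarkov := mul_meas_ge_le_lintegral₀ (μ := volume)
    (measurable_measure_prodMk_left hUm.compl).aemeasurable 2⁻¹ (f := g)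
  have hsub : {α : Fin m → Fin d → UnitAddCircle | ∃ b, ∀ n : Fin d → ℤ, (∀ j, |n j| < N) →
      linearForms n α - b ∉ cube m (2 * η)} ⊆ {α | 2⁻¹ ≤ g α} := by
    -- If the fibre V over α has measure above 1/2, it meets its translate by -b, so x and x + b
    -- both lie in V. Subtracting their approximations αq ≈ x and αq' ≈ x + b gives α(q' - q) ≈ b
    -- with error below 2η. Thus one large fibre covers every target b at once, and Markov's
    -- inequality controls the remaining α.
    rintro α ⟨b, hb⟩
    by_contra hα
    simp only [Set.mem_ofPred_eq, not_le] at hα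
    set V := Prod.mk α ⁻¹' U with hV
    have hVm : MeasurableSet V := measurable_prodMk_left hUm
    have hVc : volume Vᶜ < 2⁻¹ := hα
    have hV'c : volume ((fun x => x + b) ⁻¹' Vᶜ) < 2⁻¹ := by
      rwa [measure_preimage_add_right]
    obtain ⟨x, hx, hx'⟩ : ∃ x, x ∈ V ∧ x + b ∈ V := by
      by_contra! hcon
      have : (Set.univ : Set (Fin m → UnitAddCircle)) ⊆ Vᶜ ∪ (fun x => x + b) ⁻¹' Vᶜ := by
        intro x _
        by_cases hx : x ∈ V
        · exact Or.inr (hcon x hx)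
        · exact Or.inl hx
      have h2 := (measure_mono this).trans (measure_union_le (μ := volume) _ _)
      rw [measure_univ] at h2
      have h3 := ENNReal.add_lt_add hVc hV'c
      rw [ENNReal.inv_two_add_inv_two] at h3
      exact absurd h2 (not_le.2 h3)
    obtain ⟨q, hq, hqx⟩ := Set.mem_iUnion₂.1 hx
    obtain ⟨q', hq', hqx'⟩ := Set.mem_iUnion₂.1 hx'
    refine hb (q' - q) ?_ ?_
    · intro j
      have h2 := Finset.mem_Ico.1 (Fintype.mem_piFinset.1 hq j)
      have h3 := Finset.mem_Ico.1 (Fintype.mem_piFinset.1 hq' j)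
      rw [Pi.sub_apply, abs_lt]
      constructor <;> linarith [h2.1, h2.2, h3.1, h3.2]
    · have := sub_mem_cube hqx' hqx
      rw [affineForms_apply, affineForms_apply] at this
      rw [linearForms_sub]
      convert this using 1
      simp only
      abel
  refine (measure_mono hsub).trans ?_
  rw [hint] at hmarkov
  have h5 : volume {α | 2⁻¹ ≤ g α} ≤ 2 * volume Uᶜ := by
    have := mul_le_mul_right hmarkov 2
    rwa [← mul_assoc, ENNReal.mul_inv_cancel (by simp) (by simp), one_mul] at this
  refine h5.trans ?_
  rw [← ofReal_measureReal, ← ENNReal.ofReal_ofNat 2, ← ENNReal.ofReal_mul (by norm_num)]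
  refine ENNReal.ofReal_le_ofReal ?_
  calc 2 * volume.real Uᶜ ≤ 2 * (1 / M) := by gcongr
    _ = 2 / M := by ring

end Torus

/-! ### Density, convergence part of Khinchin–Groshev, and gaps -/

namespace Torus

variable {m d : ℕ}

theorem cube_mono {ψ ψ' : ℝ} (h : ψ ≤ ψ') : cube m ψ ⊆ cube m ψ' :=
  fun _ hβ i => (hβ i).trans_le h

/-- For almost every system, the values at integer points are dense in the torus. -/
theorem ae_dense_linearForms (hd : 0 < d) :
    ∀ᵐ α : Fin m → Fin d → UnitAddCircle, ∀ η : ℝ, 0 < η → ∀ b, ∃ n : Fin d → ℤ,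
      linearForms n α - b ∈ cube m η := by
  have key : ∀ k : ℕ, ∀ᵐ α : Fin m → Fin d → UnitAddCircle, ∀ b, ∃ n : Fin d → ℤ,
      linearForms n α - b ∈ cube m (1 / ((k : ℝ) + 1)) := by
    intro k
    set η : ℝ := 1 / ((k : ℝ) + 1) with hη
    have hη0 : 0 < η := by positivity
    have hη1 : η ≤ 1 := by
      rw [hη, div_le_one (by positivity)]
      linarith [(Nat.cast_nonneg k : (0 : ℝ) ≤ k)]
    rw [ae_iff]
    refine le_antisymm ?_ zero_le
    have hle : ∀ N : ℕ, volume {α : Fin m → Fin d → UnitAddCircle | ¬ ∀ b, ∃ n : Fin d → ℤ,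
        linearForms n α - b ∈ cube m η}
        ≤ ENNReal.ofReal (2 / (((N + 1 : ℕ) : ℝ) ^ d * η ^ m)) := by
      intro N
      have := volume_not_covered_le (m := m) (d := d) N.succ_pos (η := η / 2) (by positivity)
        (by linarith)
      rw [mul_div_cancel₀ _ (two_ne_zero)] at this
      refine le_trans (measure_mono ?_) this
      intro α hα
      obtain ⟨b, hb⟩ := not_forall.1 hα
      exact ⟨b, fun n _ => not_exists.1 hb n⟩
    have hlim : Tendsto (fun N : ℕ => ENNReal.ofReal (2 / (((N + 1 : ℕ) : ℝ) ^ d * η ^ m)))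
        atTop (nhds 0) := by
      rw [← ENNReal.ofReal_zero]
      refine ENNReal.tendsto_ofReal (Tendsto.div_atTop tendsto_const_nhds ?_)
      refine Tendsto.atTop_mul_const (by positivity) ?_
      exact (tendsto_pow_atTop hd.ne').comp
        (tendsto_natCast_atTop_atTop.comp (tendsto_add_atTop_nat 1))
    exact ge_of_tendsto' hlim hle
  filter_upwards [ae_all_iff.2 key] with α hα η hη b
  obtain ⟨k, hk⟩ := exists_nat_one_div_lt hη
  obtain ⟨n, hn⟩ := hα k b
  exact ⟨n, cube_mono hk.le hn⟩

theorem volume_exists_mem_cube_le {X ψ : ℝ} (hX : 0 ≤ X) (hψ : 0 ≤ ψ) :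
    volume {α : Fin m → Fin d → UnitAddCircle | ∃ q : Fin d → ℤ, q ≠ 0 ∧ (∀ l, |(q l : ℝ)| ≤ X) ∧
      linearForms q α ∈ cube m ψ} ≤ ENNReal.ofReal ((3 * X) ^ d * (2 * ψ) ^ m) := by
  classical
  -- For X < 1 no nonzero q is admissible. For X ≥ 1 the side count satisfies 2⌊X⌋ + 1 ≤ 3X, so a
  -- union bound suffices.
  by_cases hX1 : X < 1
  · have : {α : Fin m → Fin d → UnitAddCircle | ∃ q : Fin d → ℤ, q ≠ 0 ∧ (∀ l, |(q l : ℝ)| ≤ X) ∧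
      linearForms q α ∈ cube m ψ} = ∅ := by
      rw [Set.eq_empty_iff_forall_notMem]
      rintro α ⟨q, hq, hqX, -⟩
      obtain ⟨l, hl⟩ := Function.ne_iff.1 hq
      have h1 : (1 : ℤ) ≤ |q l| := Int.one_le_abs hl
      have h2 : (1 : ℝ) ≤ |(q l : ℝ)| := by exact_mod_cast h1
      linarith [hqX l]
    rw [this, measure_empty]
    exact zero_le
  push Not at hX1
  set S : Finset (Fin d → ℤ) :=
    (Fintype.piFinset fun _ => Finset.Icc (-⌊X⌋) ⌊X⌋).filter (· ≠ 0) with hS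
  have hfl : (0 : ℤ) ≤ ⌊X⌋ := Int.floor_nonneg.2 hX
  have hScard : (S.card : ℝ) ≤ (3 * X) ^ d := by
    have h1 : S.card ≤ (2 * ⌊X⌋ + 1).toNat ^ d := by
      refine (Finset.card_filter_le _ _).trans ?_
      rw [Fintype.card_piFinset]
      simp only [Int.card_Icc, Finset.prod_const, Finset.card_univ, Fintype.card_fin]
      refine le_of_eq ?_
      congr 2
      ring
    calc (S.card : ℝ) ≤ (((2 * ⌊X⌋ + 1).toNat ^ d : ℕ) : ℝ) := by exact_mod_cast h1
      _ = (2 * (⌊X⌋ : ℝ) + 1) ^ d := by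
        rw [Nat.cast_pow]
        congr 1
        have : (((2 * ⌊X⌋ + 1).toNat : ℤ) : ℝ) = ((2 * ⌊X⌋ + 1 : ℤ) : ℝ) := by
          rw [Int.toNat_of_nonneg (by omega)]
        push_cast at this
        exact this
      _ ≤ (3 * X) ^ d := by
        have h0 : (0 : ℝ) ≤ ⌊X⌋ := by exact_mod_cast hfl
        gcongr
        linarith [Int.floor_le X]
  have hsub : {α : Fin m → Fin d → UnitAddCircle | ∃ q : Fin d → ℤ, q ≠ 0 ∧ (∀ l, |(q l : ℝ)| ≤ X) ∧
      linearForms q α ∈ cube m ψ} ⊆ ⋃ q ∈ S, linearForms q ⁻¹' cube m ψ := by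
    rintro α ⟨q, hq, hqX, hqα⟩
    refine Set.mem_biUnion (Finset.mem_coe.2 (Finset.mem_filter.2 ⟨Fintype.mem_piFinset.2 ?_, hq⟩)) hqα
    intro l
    have := abs_le.1 (hqX l)
    rw [Finset.mem_Icc]
    refine ⟨?_, Int.le_floor.2 this.2⟩
    rw [neg_le]
    refine Int.le_floor.2 ?_
    push_cast
    linarith [this.1]
  refine (measure_mono hsub).trans ((measure_biUnion_finset_le _ _).trans ?_)
  have hterm : ∀ q ∈ S, volume ((linearForms q : (Fin m → Fin d → UnitAddCircle) → _) ⁻¹' cube m ψ)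
      ≤ ENNReal.ofReal ((2 * ψ) ^ m) := by
    intro q hq
    rw [← ofReal_measureReal,
      volume_real_linearForms_preimage_cube (Finset.mem_filter.1 hq).2 hψ]
    refine ENNReal.ofReal_le_ofReal ?_
    gcongr
    exact min_le_right _ _
  refine (Finset.sum_le_sum hterm).trans ?_
  rw [Finset.sum_const, nsmul_eq_mul, ← ENNReal.ofReal_natCast, ← ENNReal.ofReal_mul (by positivity)]
  refine ENNReal.ofReal_le_ofReal ?_
  gcongr

/-- The convergence part of the Khinchin–Groshev theorem. -/
theorem ae_eventually_notMem_cube {X ψ : ℕ → ℝ} (hX : ∀ j, 0 ≤ X j) (hψ : ∀ j, 0 ≤ ψ j)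
    (hsum : Summable fun j => X j ^ d * ψ j ^ m) :
    ∀ᵐ α : Fin m → Fin d → UnitAddCircle, ∀ᶠ j in atTop, ∀ q : Fin d → ℤ, q ≠ 0 →
      (∀ l, |(q l : ℝ)| ≤ X j) → linearForms q α ∉ cube m (ψ j) := by
  have h := ae_eventually_notMem (μ := volume) (s := fun j =>
    {α : Fin m → Fin d → UnitAddCircle | ∃ q : Fin d → ℤ, q ≠ 0 ∧ (∀ l, |(q l : ℝ)| ≤ X j) ∧
      linearForms q α ∈ cube m (ψ j)}) (by
    refine ne_top_of_le_ne_top ?_ (ENNReal.tsum_le_tsum fun j =>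
      volume_exists_mem_cube_le (hX j) (hψ j))
    have hs : Summable fun j => (3 * X j) ^ d * (2 * ψ j) ^ m := by
      refine (hsum.mul_left (3 ^ d * 2 ^ m)).congr fun j => ?_
      rw [mul_pow, mul_pow]
      ring
    exact hs.tsum_ofReal_ne_top)
  filter_upwards [h] with α hα
  filter_upwards [hα] with j hj q hq hqX hqα
  exact hj ⟨q, hq, hqX, hqα⟩

/-- For almost every system, the values of each form at the integer points of size at most `2 ^ j`
leave only gaps of length about `j ^ (1 + ε) / 2 ^ (d j)`. -/
theorem ae_eventually_covered (hd : 0 < d) {ε : ℝ} (hε : 0 < ε) :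
    ∀ᵐ α : Fin m → Fin d → UnitAddCircle, ∀ᶠ j : ℕ in atTop, ∀ i, ∀ b : UnitAddCircle,
      ∃ n : Fin d → ℤ, (∀ l, |n l| < 2 ^ j) ∧
        ‖(∑ l, n l • α i l) - b‖ < (j : ℝ) ^ (1 + ε) / 2 ^ (j * d) := by
  set δ : ℕ → ℝ := fun j => (j : ℝ) ^ (1 + ε) / 2 ^ (j * d) with hδ
  have hδlim : ∀ᶠ j in atTop, δ j ≤ 1 := by
    have h1 : Tendsto (fun x : ℝ => x ^ (1 + ε) * Real.exp (-Real.log 2 * x)) atTop (nhds 0) :=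
      tendsto_rpow_mul_exp_neg_mul_atTop_nhds_zero _ _ (Real.log_pos one_lt_two)
    have h2 := h1.comp tendsto_natCast_atTop_atTop
    filter_upwards [h2.eventually_le_const one_pos] with j hj
    refine le_trans ?_ hj
    simp only [hδ, Function.comp]
    rw [div_eq_mul_inv]
    gcongr
    rw [neg_mul, Real.exp_neg, mul_comm (Real.log 2), Real.exp_nat_mul, Real.exp_log two_pos]
    gcongr
    · norm_num
    · exact Nat.le_mul_of_pos_right j hd
  -- Each row is treated on its own. Covering the m-dimensional torus would only give gaps of order
  -- 2^(-jd/m), whereas a single row gives nearly 2^(-jd).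
  have hmap : ∀ i : Fin m, MeasurePreserving
      (fun α : Fin m → Fin d → UnitAddCircle => (fun _ => α i : Fin 1 → Fin d → UnitAddCircle)) := by
    intro i
    refine AddMonoidHom.measurePreserving (f := AddMonoidHom.mk'
      (fun α : Fin m → Fin d → UnitAddCircle => (fun _ => α i : Fin 1 → Fin d → UnitAddCircle))
      fun α β => rfl) (continuous_pi fun _ => continuous_apply i) ?_ (by simp)
    intro β
    refine ⟨fun _ => β 0, ?_⟩
    ext k l
    rw [Subsingleton.elim k 0]
    rfl
  suffices h : ∀ᵐ β : Fin 1 → Fin d → UnitAddCircle, ∀ᶠ j : ℕ in atTop, ∀ b : UnitAddCircle,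
      ∃ n : Fin d → ℤ, (∀ l, |n l| < 2 ^ j) ∧ ‖(∑ l, n l • β 0 l) - b‖ < δ j by
    have h' := ae_all_iff.2 fun i : Fin m => (hmap i).quasiMeasurePreserving.ae h
    filter_upwards [h'] with α hα
    exact eventually_all.2 hα
  -- The covering bound with N = 2^j and η = δ j / 2 gives measure at most 2 / j^(1+ε), which is
  -- summable. The guard 0 < j ∧ δ j ≤ 1 supplies the hypotheses of that bound and holds for all
  -- large j.
  have h := ae_eventually_notMem (μ := volume) (s := fun j =>
    {β : Fin 1 → Fin d → UnitAddCircle | (0 < j ∧ δ j ≤ 1) ∧ ∃ b, ∀ n : Fin d → ℤ,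
      (∀ l, |n l| < (2 ^ j : ℕ)) → linearForms n β - b ∉ cube 1 (δ j)}) (by
    have hs : Summable fun j : ℕ => 2 * (1 / (j : ℝ) ^ (1 + ε)) :=
      (Real.summable_one_div_nat_rpow.2 (by linarith)).mul_left 2
    refine ne_top_of_le_ne_top hs.tsum_ofReal_ne_top (ENNReal.tsum_le_tsum fun j => ?_)
    by_cases hj : 0 < j ∧ δ j ≤ 1
    · have hj0 : (0 : ℝ) < j := by exact_mod_cast hj.1
      have hδ0 : 0 < δ j := by positivity
      have := volume_not_covered_le (m := 1) (d := d) (N := 2 ^ j) (by positivity) (η := δ j / 2)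
        (by positivity) (by linarith [hj.2])
      rw [mul_div_cancel₀ _ (two_ne_zero)] at this
      refine (measure_mono ?_).trans (this.trans (ENNReal.ofReal_le_ofReal (le_of_eq ?_)))
      · rintro β ⟨-, hb⟩
        exact hb
      · simp only [hδ, pow_one, Nat.cast_pow, Nat.cast_ofNat, ← pow_mul]
        field_simp
    · simp [hj])
  filter_upwards [h] with β hβ
  filter_upwards [hβ, hδlim, eventually_gt_atTop 0] with j hj hj1 hj0 b
  by_contra! hcon
  refine hj ⟨⟨hj0, hj1⟩, fun _ => b, fun n hn hmem => ?_⟩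
  have := hmem 0
  rw [Pi.sub_apply, linearForms_apply] at this
  exact absurd this (not_lt.2 (hcon n fun l => by simpa using hn l))

end Torus

/-! ### Neighbourhoods of the points of exact order q on the circle -/

namespace UnitAddCircle

/-- The points of the circle of exact order `n`. -/
noncomputable def pointsOfOrder (n : ℕ) : Finset UnitAddCircle :=
  if h : 0 < n then (AddCircle.finite_setOfPred_addOrderOf_eq (1 : ℝ) h).toFinset else ∅

theorem mem_pointsOfOrder {n : ℕ} (h : 0 < n) {x : UnitAddCircle} :
    x ∈ pointsOfOrder n ↔ addOrderOf x = n := by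
  simp [pointsOfOrder, h]

theorem card_pointsOfOrder {n : ℕ} (h : 0 < n) : (pointsOfOrder n).card = n.totient := by
  rw [← AddCircle.card_addOrderOf_eq_totient (1 : ℝ) (n := n), ← Nat.card_eq_finsetCard]
  exact Nat.card_congr (Equiv.subtypeEquivRight fun x => mem_pointsOfOrder h)

theorem norm_eq_abs_div_of_nsmul_eq_zero {n : ℕ} (hn : 0 < n) {u : UnitAddCircle}
    (hu : n • u = 0) : ∃ k : ℤ, u = ((k / n : ℝ) : UnitAddCircle) ∧ ‖u‖ = |(k : ℝ)| / n := by
  have hn' : (n : ℝ) ≠ 0 := by exact_mod_cast hn.ne'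
  obtain ⟨k, -, hk⟩ := (AddCircle.nsmul_eq_zero_iff (p := (1 : ℝ)) hn).1 hu
  rw [mul_one] at hk
  -- Subtracting the nearest integer makes k / n the representative whose absolute value is the
  -- norm.
  refine ⟨k - round ((k : ℝ) / n) * n, ?_, ?_⟩
  · rw [← hk]
    have : (((k - round ((k : ℝ) / n) * n : ℤ) : ℝ) / n : ℝ)
        = (k : ℝ) / n - (round ((k : ℝ) / n) : ℤ) • (1 : ℝ) := by
      push_cast
      rw [zsmul_eq_mul]
      field_simp
    rw [this, AddCircle.coe_sub, AddCircle.coe_zsmul, AddCircle.coe_period]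
    simp
  · rw [← hk, UnitAddCircle.norm_eq, ← abs_of_pos (show (0 : ℝ) < n by exact_mod_cast hn), ← abs_div,
      abs_of_pos (show (0 : ℝ) < n by exact_mod_cast hn)]
    congr 1
    push_cast
    field_simp

theorem one_le_mul_norm {n : ℕ} (hn : 0 < n) {u : UnitAddCircle} (hu : n • u = 0) (h0 : u ≠ 0) :
    1 ≤ n * ‖u‖ := by
  obtain ⟨k, hk, hk'⟩ := norm_eq_abs_div_of_nsmul_eq_zero hn hu
  have hn' : (n : ℝ) ≠ 0 := by exact_mod_cast hn.ne'
  have : k ≠ 0 := by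
    rintro rfl
    simp [hk] at h0
  rw [hk', mul_div_cancel₀ _ hn']
  exact_mod_cast Int.one_le_abs this

/-- Such points are k / n with 0 < |k| ≤ nΔ. Excluding 0 removes the usual additive error, so the
bound remains useful when nΔ is small. -/
theorem card_le_of_nsmul_eq_zero_of_norm_lt {n : ℕ} (hn : 0 < n) {Δ : ℝ} (hΔ : 0 ≤ Δ)
    (S : Finset UnitAddCircle) (hS : ∀ u ∈ S, n • u = 0 ∧ u ≠ 0 ∧ ‖u‖ < Δ) :
    (S.card : ℝ) ≤ 2 * (n * Δ) := by
  classical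
  have hnpos : (0 : ℝ) < n := by exact_mod_cast hn
  have h : ∀ u : S, ∃ k : ℤ, (u : UnitAddCircle) = ((k / n : ℝ) : UnitAddCircle)
      ∧ ‖(u : UnitAddCircle)‖ = |(k : ℝ)| / n :=
    fun u => norm_eq_abs_div_of_nsmul_eq_zero hn (hS u u.2).1
  choose f hf hf' using h
  set B : ℤ := ⌊n * Δ⌋ with hB
  have hB0 : 0 ≤ B := Int.floor_nonneg.2 (by positivity)
  have hmaps : ∀ u ∈ (Finset.univ : Finset S), f u ∈ (Finset.Icc (-B) B).erase 0 := by
    intro u _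
    rw [Finset.mem_erase, Finset.mem_Icc, ← abs_le]
    refine ⟨fun h0 => (hS u u.2).2.1 ?_, ?_⟩
    · rw [hf u, h0]
      simp
    · refine Int.le_floor.2 ?_
      have := (hS u u.2).2.2
      rw [hf' u, div_lt_iff₀ hnpos] at this
      push_cast
      linarith
  have hinj : Set.InjOn f (Finset.univ : Finset S) := by
    intro u _ v _ huv
    ext
    rw [hf u, hf v, huv]
  have hcard := Finset.card_le_card_of_injOn f hmaps hinj
  rw [Finset.card_univ, Fintype.card_coe, Finset.card_erase_of_mem (by simp [hB0]),
    Int.card_Icc] at hcard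
  have h2 : (S.card : ℤ) ≤ 2 * B := by omega
  have h3 : (S.card : ℝ) ≤ 2 * (B : ℝ) := by exact_mod_cast h2
  linarith [Int.floor_le (n * Δ)]

theorem card_le_of_nsmul_eq_zero {n : ℕ} (hn : 0 < n) (S : Finset UnitAddCircle)
    (hS : ∀ u ∈ S, n • u = 0) : S.card ≤ n := by
  have h1 := AddCircle.card_torsion_le_of_isSMulRegular (1 : ℝ) n hn.ne'
    (.of_right_eq_zero_of_smul fun _ ↦ by simp [hn.ne'])
  have h2 : ((S : Set UnitAddCircle)).encard ≤ n := (Set.encard_mono fun u hu => hS u hu).trans h1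
  rw [Set.encard_coe_eq_coe_finsetCard] at h2
  exact_mod_cast h2

/-- The points within `a / q` of a point of exact order `q`. -/
def nearOrder (q : ℕ) (a : ℝ) : Set UnitAddCircle := ⋃ y ∈ pointsOfOrder q, Metric.ball y (a / q)

theorem measurableSet_nearOrder (q : ℕ) (a : ℝ) : MeasurableSet (nearOrder q a) :=
  Finset.measurableSet_biUnion _ fun _ _ => Metric.isOpen_ball.measurableSet

theorem norm_nsmul_lt_of_mem_nearOrder {q : ℕ} (hq : 0 < q) {a : ℝ} {x : UnitAddCircle}
    (hx : x ∈ nearOrder q a) : ‖q • x‖ < a := by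
  obtain ⟨y, hy, hxy⟩ := Set.mem_iUnion₂.1 hx
  have hq' : (0 : ℝ) < q := by exact_mod_cast hq
  have h1 : q • y = 0 := by
    rw [← (mem_pointsOfOrder hq).1 hy]
    exact addOrderOf_nsmul_eq_zero y
  rw [Metric.mem_ball, dist_eq_norm, lt_div_iff₀ hq', mul_comm] at hxy
  calc ‖q • x‖ = ‖q • (x - y)‖ := by rw [nsmul_sub, h1, sub_zero]
    _ ≤ q * ‖x - y‖ := norm_nsmul_le
    _ < a := hxy

theorem volume_real_nearOrder {q : ℕ} (hq : 0 < q) {a : ℝ} (ha : 0 ≤ a) (ha' : 2 * a ≤ 1) :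
    volume.real (nearOrder q a) = q.totient * (2 * (a / q)) := by
  have hq' : (1 : ℝ) ≤ q := by exact_mod_cast hq
  rw [nearOrder, measureReal_biUnion_finset]
  · rw [Finset.sum_congr rfl fun y _ => UnitAddCircle.volume_real_ball y (by positivity),
      Finset.sum_const, card_pointsOfOrder hq, nsmul_eq_mul, min_eq_right]
    calc 2 * (a / q) = 2 * a / q := by ring
      _ ≤ 1 := by rw [div_le_one (by linarith)]; linarith
  · intro y hy z hz hyz
    rw [Finset.mem_coe, mem_pointsOfOrder hq] at hy hz
    refine Metric.ball_disjoint_ball ?_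
    have h1 : q • (y - z) = 0 := by
      rw [nsmul_sub]
      nth_rw 1 [← hy]
      rw [← hz, addOrderOf_nsmul_eq_zero, addOrderOf_nsmul_eq_zero, sub_zero]
    have h2 := one_le_mul_norm hq h1 (sub_ne_zero.2 hyz)
    rw [dist_eq_norm, ← add_div, div_le_iff₀ (by linarith)]
    linarith
  · exact fun _ _ => Metric.isOpen_ball.measurableSet

/-- Only pairs of centres closer than Δ = a/q + b/q' contribute. Their difference is nonzero, since
the exact orders differ, and is killed by lcm(q, q'), which leaves at most 2 lcm(q, q') Δ
differences. Two pairs with the same difference differ by an element killed by both q and q', so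
each difference occurs at most gcd(q, q') times. Hence there are at most 2qq'Δ pairs, each
contributing at most 2 min(a/q, b/q'). -/
theorem volume_real_nearOrder_inter_le {q q' : ℕ} (hq : 0 < q) (hq' : 0 < q') (hne : q ≠ q')
    {a b : ℝ} (ha : 0 ≤ a) (hb : 0 ≤ b) :
    volume.real (nearOrder q a ∩ nearOrder q' b) ≤ 8 * a * b := by
  classical
  have hqR : (0 : ℝ) < q := by exact_mod_cast hq
  have hqR' : (0 : ℝ) < q' := by exact_mod_cast hq'
  set Δ := a / q + b / q' with hΔ
  have hΔ0 : 0 ≤ Δ := by positivity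
  set S := (pointsOfOrder q ×ˢ pointsOfOrder q').filter fun p => ‖p.1 - p.2‖ < Δ with hS
  have hSmem : ∀ p ∈ S, q • p.1 = 0 ∧ q' • p.2 = 0 ∧ p.1 ≠ p.2 ∧ ‖p.1 - p.2‖ < Δ := by
    intro p hp
    obtain ⟨h1, h2⟩ := Finset.mem_filter.1 hp
    obtain ⟨h3, h4⟩ := Finset.mem_product.1 h1
    rw [mem_pointsOfOrder hq] at h3
    rw [mem_pointsOfOrder hq'] at h4
    refine ⟨?_, ?_, ?_, h2⟩
    · rw [← h3, addOrderOf_nsmul_eq_zero]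
    · rw [← h4, addOrderOf_nsmul_eq_zero]
    · rintro h5
      rw [h5] at h3
      exact hne (h3.symm.trans h4)
  have hlcm : 0 < q.lcm q' := Nat.lcm_pos hq hq'
  have hgcd : 0 < q.gcd q' := Nat.gcd_pos_of_pos_left _ hq
  have hcard : (S.card : ℝ) ≤ 2 * (q * q') * Δ := by
    have h1 : S.card ≤ q.gcd q' * (S.image fun p => p.1 - p.2).card := by
      refine Finset.card_le_mul_card_image S _ fun u _ => ?_
      rcases (S.filter fun p => p.1 - p.2 = u).eq_empty_or_nonempty with h | ⟨p₀, hp₀⟩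
      · rw [h]
        simp
      obtain ⟨hp₀S, hp₀u⟩ := Finset.mem_filter.1 hp₀
      have hinj : Set.InjOn (fun p : UnitAddCircle × UnitAddCircle => p.1 - p₀.1)
          (S.filter fun p => p.1 - p.2 = u) := by
        intro p hp p' hp' hpp
        have e1 := (Finset.mem_filter.1 hp).2
        have e2 := (Finset.mem_filter.1 hp').2
        have e3 : p.1 = p'.1 := sub_left_injective hpp
        refine Prod.ext e3 ?_
        rw [← e2, e3] at e1
        exact sub_right_injective e1
      rw [← Finset.card_image_of_injOn hinj]
      refine card_le_of_nsmul_eq_zero hgcd _ fun v hv => ?_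
      obtain ⟨p, hp, rfl⟩ := Finset.mem_image.1 hv
      obtain ⟨hpS, hpu⟩ := Finset.mem_filter.1 hp
      have e1 := hSmem p hpS
      have e2 := hSmem p₀ hp₀S
      have e3 : p.1 - p₀.1 = p.2 - p₀.2 := by
        rw [← hp₀u] at hpu
        rw [sub_eq_sub_iff_add_eq_add] at hpu ⊢
        rw [hpu, add_comm]
      rw [← addOrderOf_dvd_iff_nsmul_eq_zero]
      refine Nat.dvd_gcd ?_ ?_
      · rw [addOrderOf_dvd_iff_nsmul_eq_zero, nsmul_sub, e1.1, e2.1, sub_zero]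
      · rw [e3, addOrderOf_dvd_iff_nsmul_eq_zero, nsmul_sub, e1.2.1, e2.2.1, sub_zero]
    have h2 := card_le_of_nsmul_eq_zero_of_norm_lt hlcm hΔ0 (S.image fun p => p.1 - p.2) (by
      intro u hu
      obtain ⟨p, hp, rfl⟩ := Finset.mem_image.1 hu
      obtain ⟨e1, e2, e3, e4⟩ := hSmem p hp
      refine ⟨?_, sub_ne_zero.2 e3, e4⟩
      obtain ⟨s, hs⟩ := Nat.dvd_lcm_left q q'
      obtain ⟨t, ht⟩ := Nat.dvd_lcm_right q q'
      rw [nsmul_sub]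
      nth_rw 1 [hs]
      rw [ht, mul_comm q, mul_comm q', mul_nsmul', mul_nsmul', e1, e2]
      simp)
    have h3 : (S.card : ℝ) ≤ (q.gcd q' : ℝ) * ((S.image fun p => p.1 - p.2).card : ℝ) := by
      exact_mod_cast h1
    have h4 : ((q.gcd q' : ℕ) : ℝ) * (q.lcm q' : ℕ) = q * q' := by
      exact_mod_cast Nat.gcd_mul_lcm q q'
    calc (S.card : ℝ) ≤ _ := h3
      _ ≤ (q.gcd q' : ℝ) * (2 * ((q.lcm q' : ℕ) * Δ)) := by gcongr
      _ = 2 * ((q.gcd q' : ℕ) * (q.lcm q' : ℕ)) * Δ := by ring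
      _ = _ := by rw [h4]
  have hsub : nearOrder q a ∩ nearOrder q' b
      ⊆ ⋃ p ∈ S, Metric.ball p.1 (a / q) ∩ Metric.ball p.2 (b / q') := by
    rintro x ⟨hx, hx'⟩
    obtain ⟨y, hy, hxy⟩ := Set.mem_iUnion₂.1 hx
    obtain ⟨z, hz, hxz⟩ := Set.mem_iUnion₂.1 hx'
    refine Set.mem_biUnion (x := (y, z))
      (Finset.mem_coe.2 (Finset.mem_filter.2 ⟨Finset.mem_product.2 ⟨hy, hz⟩, ?_⟩)) ⟨hxy, hxz⟩
    rw [← dist_eq_norm]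
    have := dist_triangle_left y z x
    have h1 := Metric.mem_ball.1 hxy
    have h2 := Metric.mem_ball.1 hxz
    linarith
  have hball : ∀ p ∈ S, volume.real (Metric.ball p.1 (a / q) ∩ Metric.ball p.2 (b / q'))
      ≤ 2 * min (a / q) (b / q') := by
    intro p _
    rw [mul_min_of_nonneg _ _ zero_le_two]
    refine le_min ?_ ?_
    · refine (measureReal_mono Set.inter_subset_left).trans ?_
      rw [UnitAddCircle.volume_real_ball _ (by positivity)]
      exact min_le_right _ _
    · refine (measureReal_mono Set.inter_subset_right).trans ?_
      rw [UnitAddCircle.volume_real_ball _ (by positivity)]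
      exact min_le_right _ _
  have hmin0 : 0 ≤ min (a / q) (b / q') := by positivity
  calc volume.real (nearOrder q a ∩ nearOrder q' b)
      ≤ volume.real (⋃ p ∈ S, Metric.ball p.1 (a / q) ∩ Metric.ball p.2 (b / q')) :=
        measureReal_mono hsub (measure_ne_top _ _)
    _ ≤ ∑ p ∈ S, volume.real (Metric.ball p.1 (a / q) ∩ Metric.ball p.2 (b / q')) :=
        measureReal_biUnion_finset_le _ _
    _ ≤ ∑ p ∈ S, 2 * min (a / q) (b / q') := Finset.sum_le_sum hball
    _ = S.card * (2 * min (a / q) (b / q')) := by rw [Finset.sum_const, nsmul_eq_mul]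
    _ ≤ 2 * (q * q') * Δ * (2 * min (a / q) (b / q')) := by gcongr
    _ = 4 * (a * (q' * min (a / q) (b / q')) + b * (q * min (a / q) (b / q'))) := by
        rw [hΔ]
        field_simp
        ring
    _ ≤ 4 * (a * (q' * (b / q')) + b * (q * (a / q))) := by
        gcongr
        · exact min_le_right _ _
        · exact min_le_left _ _
    _ = 8 * a * b := by
        field_simp
        ring

end UnitAddCircle

/-! ### Counting primitive vectors and integers with large totient -/

/-- A telescoping bound. What matters is a constant below 1, so that the non-primitive vectors do
not exhaust the box. -/
theorem sum_one_div_sq_Icc_two_le (N : ℕ) : ∑ g ∈ Finset.Icc 2 N, 1 / (g : ℝ) ^ 2 ≤ 3 / 4 := by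
  rcases Nat.lt_or_ge N 2 with h | h
  · rw [Finset.Icc_eq_empty (by omega)]
    norm_num
  suffices h' : ∑ g ∈ Finset.Icc 2 N, 1 / (g : ℝ) ^ 2 ≤ 3 / 4 - 1 / (N : ℝ) by
    have : (0 : ℝ) ≤ 1 / N := by positivity
    linarith
  induction N, h using Nat.le_induction with
  | base => norm_num
  | succ n hn ih =>
    rw [Finset.sum_Icc_succ_top (by omega)]
    have hn' : (0 : ℝ) < n := by exact_mod_cast (by omega : 0 < n)
    have : 1 / ((n + 1 : ℕ) : ℝ) ^ 2 ≤ 1 / n - 1 / ((n + 1 : ℕ) : ℝ) := by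
      push_cast
      rw [div_sub_div _ _ hn'.ne' (by positivity), div_le_div_iff₀ (by positivity) (by positivity)]
      nlinarith
    linarith

/-- The vectors with coprime coordinates in `[1, N]`. -/
def primitiveVectors (d N : ℕ) : Finset (Fin d → ℕ) :=
  (Fintype.piFinset fun _ => Finset.Icc 1 N).filter fun q => Finset.univ.gcd q = 1

theorem card_multiples_Icc (N g : ℕ) :
    ((Finset.Icc 1 N).filter (g ∣ ·)).card = N / g := by
  have : Finset.Icc 1 N = Finset.Ioc 0 N := by
    ext
    simp [Nat.succ_le_iff]
  rw [this, Nat.Ioc_filter_dvd_card_eq_div]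

/-- A non-primitive vector is divisible by some g between 2 and N, and at most (N/g)^d vectors are
divisible by g. For d ≥ 2 these counts sum to at most 3/4 of the box. -/
theorem card_primitiveVectors_ge {d : ℕ} (hd : 2 ≤ d) (N : ℕ) :
    (N : ℝ) ^ d / 4 ≤ (primitiveVectors d N).card := by
  classical
  set A : Finset (Fin d → ℕ) := Fintype.piFinset fun _ => Finset.Icc 1 N with hA
  have hAcard : (A.card : ℝ) = (N : ℝ) ^ d := by simp [hA]
  have hsub : A.filter (fun q => ¬ Finset.univ.gcd q = 1)
      ⊆ (Finset.Icc 2 N).biUnion fun g =>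
        Fintype.piFinset fun _ : Fin d => (Finset.Icc 1 N).filter (g ∣ ·) := by
    intro q hq
    obtain ⟨hqA, hq1⟩ := Finset.mem_filter.1 hq
    have hqA' := fun l => Finset.mem_Icc.1 (Fintype.mem_piFinset.1 hqA l)
    have hdvd : ∀ l, Finset.univ.gcd q ∣ q l := fun l => Finset.gcd_dvd (Finset.mem_univ l)
    have l0 : Fin d := ⟨0, by omega⟩
    refine Finset.mem_biUnion.2 ⟨Finset.univ.gcd q, Finset.mem_Icc.2 ⟨?_, ?_⟩,
      Fintype.mem_piFinset.2 fun l => Finset.mem_filter.2 ⟨Finset.mem_Icc.2 (hqA' l), hdvd l⟩⟩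
    · have : Finset.univ.gcd q ≠ 0 := fun h0 => by
        have := hdvd l0
        rw [h0, zero_dvd_iff] at this
        have := (hqA' l0).1
        omega
      omega
    · exact (Nat.le_of_dvd (hqA' l0).1 (hdvd l0)).trans (hqA' l0).2
  have hbad : ((A.filter (fun q => ¬ Finset.univ.gcd q = 1)).card : ℝ) ≤ 3 / 4 * (N : ℝ) ^ d := by
    have h1 : ((A.filter (fun q => ¬ Finset.univ.gcd q = 1)).card : ℝ)
        ≤ ∑ g ∈ Finset.Icc 2 N, ((N / g : ℕ) : ℝ) ^ d := by
      have := (Finset.card_le_card hsub).trans Finset.card_biUnion_le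
      rw [Finset.sum_congr rfl fun g _ => by
        rw [Fintype.card_piFinset, Finset.prod_const, Finset.card_univ, Fintype.card_fin,
          card_multiples_Icc N g]] at this
      exact_mod_cast this
    refine h1.trans ?_
    calc ∑ g ∈ Finset.Icc 2 N, ((N / g : ℕ) : ℝ) ^ d
        ≤ ∑ g ∈ Finset.Icc 2 N, 1 / (g : ℝ) ^ 2 * (N : ℝ) ^ d := by
          refine Finset.sum_le_sum fun g hg => ?_
          have hg2 : (1 : ℝ) ≤ g := by
            exact_mod_cast (by have := (Finset.mem_Icc.1 hg).1; omega : 1 ≤ g)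
          calc ((N / g : ℕ) : ℝ) ^ d ≤ ((N : ℝ) / g) ^ d := by
                gcongr
                exact Nat.cast_div_le
            _ = 1 / (g : ℝ) ^ d * (N : ℝ) ^ d := by rw [div_pow]; ring
            _ ≤ 1 / (g : ℝ) ^ 2 * (N : ℝ) ^ d := by gcongr
      _ = (∑ g ∈ Finset.Icc 2 N, 1 / (g : ℝ) ^ 2) * (N : ℝ) ^ d := by rw [Finset.sum_mul]
      _ ≤ 3 / 4 * (N : ℝ) ^ d := by
          gcongr
          exact sum_one_div_sq_Icc_two_le N
  have hsplit := Finset.card_filter_add_card_filter_not (s := A)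
    (fun q : Fin d → ℕ => Finset.univ.gcd q = 1)
  have hsplit' : ((primitiveVectors d N).card : ℝ)
      + (A.filter (fun q => ¬ Finset.univ.gcd q = 1)).card = (N : ℝ) ^ d := by
    rw [← hAcard]
    exact_mod_cast hsplit
  linarith

theorem card_coprime_Icc_self (b : ℕ) :
    ((Finset.Icc 1 b).filter fun a => b.Coprime a).card = b.totient := by
  have : Finset.Icc 1 b = Finset.Ico 1 (1 + b) := by
    ext
    simp [add_comm]
  rw [this, Nat.filter_coprime_Ico_eq_totient]

/-- Given the larger coordinate b, the smaller one is coprime to b and at most b, hence has at most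
φ(b) values; the factor 2 accounts for which coordinate is larger. Combined with the count of
primitive pairs, this bounds the sum of totients from below. -/
theorem card_primitiveVectors_two_le (N : ℕ) :
    (primitiveVectors 2 N).card ≤ 2 * ∑ b ∈ Finset.Icc 1 N, b.totient := by
  classical
  have hhalf : ∀ i i' : Fin 2, i ≠ i' → ((primitiveVectors 2 N).filter fun q => q i ≤ q i').card
      ≤ ∑ b ∈ Finset.Icc 1 N, b.totient := by
    intro i i' hii'
    have huniv : (Finset.univ : Finset (Fin 2)) = {i, i'} := by
      ext k
      simp only [Finset.mem_univ, Finset.mem_insert, Finset.mem_singleton, true_iff]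
      omega
    have hall : ∀ k, k = i ∨ k = i' := fun k => by
      have := Finset.mem_univ k
      rw [huniv] at this
      simpa using this
    rw [Finset.card_eq_sum_card_fiberwise (f := fun q => q i') (t := Finset.Icc 1 N)]
    · refine Finset.sum_le_sum fun b _ => ?_
      rw [← card_coprime_Icc_self]
      refine Finset.card_le_card_of_injOn (fun q => q i) ?_ ?_
      · intro q hq
        obtain ⟨hq1, hq2⟩ := Finset.mem_filter.1 hq
        obtain ⟨hq3, hq4⟩ := Finset.mem_filter.1 hq1
        obtain ⟨hq5, hq6⟩ := Finset.mem_filter.1 hq3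
        have := Finset.mem_Icc.1 (Fintype.mem_piFinset.1 hq5 i)
        refine Finset.mem_coe.2 (Finset.mem_filter.2 ⟨Finset.mem_Icc.2 ⟨this.1, hq2 ▸ hq4⟩, ?_⟩)
        rw [huniv, Finset.gcd_insert, Finset.gcd_singleton] at hq6
        rw [Nat.coprime_comm, ← hq2]
        have : GCDMonoid.gcd (q i) (q i') = 1 := by simpa using hq6
        exact this
      · intro q hq q' hq' h
        have e1 := (Finset.mem_filter.1 hq).2
        have e2 := (Finset.mem_filter.1 hq').2
        ext k
        rcases hall k with rfl | rfl
        · exact h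
        · exact e1.trans e2.symm
    · intro q hq
      obtain ⟨hq3, hq4⟩ := Finset.mem_filter.1 (Finset.mem_coe.1 hq)
      exact Fintype.mem_piFinset.1 (Finset.mem_filter.1 hq3).1 i'
  have hunion : primitiveVectors 2 N ⊆ ((primitiveVectors 2 N).filter fun q => q 0 ≤ q 1)
      ∪ ((primitiveVectors 2 N).filter fun q => q 1 ≤ q 0) := by
    intro q hq
    rcases le_total (q 0) (q 1) with h | h
    · exact Finset.mem_union_left _ (Finset.mem_filter.2 ⟨hq, h⟩)
    · exact Finset.mem_union_right _ (Finset.mem_filter.2 ⟨hq, h⟩)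
  calc _ ≤ _ := Finset.card_le_card hunion
    _ ≤ _ := Finset.card_union_le _ _
    _ ≤ _ := by
      have h1 := hhalf 0 1 (by simp)
      have h2 := hhalf 1 0 (by simp)
      omega

/-- The integers in `[1, N]` whose totient is at least `N / 16`. -/
def largeTotient (N : ℕ) : Finset ℕ := (Finset.Icc 1 N).filter fun q => N ≤ 16 * q.totient

/-- The totients up to N sum to at least N²/8. Those below N/16 contribute at most N²/16, and each
of the others at most N. -/
theorem card_largeTotient_ge (N : ℕ) : (N : ℝ) / 16 ≤ (largeTotient N).card := by
  rcases N.eq_zero_or_pos with rfl | hN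
  · simp
  have hN' : (0 : ℝ) < N := by exact_mod_cast hN
  have h1 := card_primitiveVectors_ge le_rfl N
  have h2 : ((primitiveVectors 2 N).card : ℝ) ≤ 2 * ∑ b ∈ Finset.Icc 1 N, (b.totient : ℝ) := by
    exact_mod_cast card_primitiveVectors_two_le N
  have h3 : ∑ b ∈ Finset.Icc 1 N, (b.totient : ℝ) ≤ (largeTotient N).card * N + N * (N / 16) := by
    have hb : ∀ b ∈ Finset.Icc 1 N, (b.totient : ℝ) ≤ (if N ≤ 16 * b.totient then (N : ℝ) else 0) + N / 16 := by
      intro b hb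
      have hbN := (Finset.mem_Icc.1 hb).2
      split_ifs with h
      · have : (b.totient : ℝ) ≤ N := by exact_mod_cast (Nat.totient_le b).trans hbN
        linarith
      · have : ((16 * b.totient : ℕ) : ℝ) ≤ N := by exact_mod_cast (not_le.1 h).le
        push_cast at this
        linarith
    refine (Finset.sum_le_sum hb).trans (le_of_eq ?_)
    rw [Finset.sum_add_distrib, ← Finset.sum_filter, Finset.sum_const, Finset.sum_const,
      nsmul_eq_mul, nsmul_eq_mul, Nat.card_Icc, Nat.add_sub_cancel]
    rfl
  have h4 : (N : ℝ) * (N / 16) ≤ N * (largeTotient N).card := by nlinarith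
  exact le_of_mul_le_mul_left h4 hN'

/-! ### Quasi-independent families of approximation events -/

namespace Torus

variable {m d : ℕ}

/-- Cramer's rule: the targets are divided in the circle by a nonzero 2 × 2 minor, and only columns
l and l' are used. Non-parallel vectors therefore give independent values. -/
theorem surjective_linearForms_prod {q q' : Fin d → ℤ} {l l' : Fin d}
    (h : q l * q' l' - q l' * q' l ≠ 0) :
    Function.Surjective ((linearForms (m := m) q).prod (linearForms q')) := by
  rintro ⟨u, v⟩
  choose u' hu' using fun i => exists_zsmul_eq h (u i)
  choose v' hv' using fun i => exists_zsmul_eq h (v i)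
  refine ⟨fun i => Pi.single l (q' l' • u' i - q l' • v' i)
    + Pi.single l' (-(q' l) • u' i + q l • v' i), ?_⟩
  have key : ∀ (p : Fin d → ℤ) (x y : UnitAddCircle),
      ∑ k, p k • ((Pi.single l x + Pi.single l' y : Fin d → UnitAddCircle) k)
        = p l • x + p l' • y := by
    intro p x y
    simp only [Pi.add_apply, smul_add, Finset.sum_add_distrib]
    congr 1
    · rw [Finset.sum_eq_single l (fun b _ hb => by simp [hb]) (by simp), Pi.single_eq_same]
    · rw [Finset.sum_eq_single l' (fun b _ hb => by simp [hb]) (by simp), Pi.single_eq_same]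
  ext i
  · simp only [AddMonoidHom.prod_apply, linearForms_apply]
    rw [key, ← hu' i]
    module
  · simp only [AddMonoidHom.prod_apply, linearForms_apply]
    rw [key, ← hv' i]
    module

theorem volume_real_linearForms_inter {q q' : Fin d → ℤ} {l l' : Fin d}
    (h : q l * q' l' - q l' * q' l ≠ 0) {ψ ψ' : ℝ} (hψ : 0 ≤ ψ) (hψ' : 0 ≤ ψ') :
    volume.real (linearForms q ⁻¹' cube m ψ ∩ linearForms q' ⁻¹' cube m ψ')
      = min 1 (2 * ψ) ^ m * min 1 (2 * ψ') ^ m := by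
  have hmp : MeasurePreserving ((linearForms (m := m) q).prod (linearForms q')) :=
    AddMonoidHom.measurePreserving
      ((continuous_linearForms q).prodMk (continuous_linearForms q'))
      (surjective_linearForms_prod h) (by simp)
  rw [← volume_real_cube hψ, ← volume_real_cube hψ', measureReal_def, measureReal_def,
    measureReal_def, ← ENNReal.toReal_mul, ← Measure.prod_prod, ← Measure.volume_eq_prod,
    ← hmp.measure_preimage
      ((isOpen_cube ψ).measurableSet.prod (isOpen_cube ψ').measurableSet).nullMeasurableSet]
  rfl

/-- A family of integer vectors, sorted by size, and of approximation events which are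
independent up to a constant. -/
structure QuasiIndependentFamily (m d : ℕ) where
  /-- The vectors of size about `32 ^ (j + 1)`. -/
  vectors : ℕ → Finset (Fin d → ℤ)
  /-- The approximation events. -/
  event : (Fin d → ℤ) → ℝ → Set (Fin m → Fin d → UnitAddCircle)
  /-- The density constant. -/
  lower : ℝ
  /-- The independence constant. -/
  upper : ℝ
  lower_pos : 0 < lower
  upper_pos : 0 < upper
  ne_zero : ∀ {j q}, q ∈ vectors j → q ≠ 0
  abs_le : ∀ {j q}, q ∈ vectors j → ∀ l, |q l| ≤ 32 ^ (j + 1)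
  disjoint : ∀ {i j}, i < j → Disjoint (vectors i) (vectors j)
  card_ge : ∀ j, lower * ((32 : ℝ) ^ (j + 1)) ^ d ≤ (vectors j).card
  measurableSet : ∀ q ψ, MeasurableSet (event q ψ)
  subset : ∀ {j q}, q ∈ vectors j → ∀ ψ, event q ψ ⊆ linearForms q ⁻¹' cube m ψ
  volume_ge : ∀ {j q}, q ∈ vectors j → ∀ {ψ : ℝ}, 0 ≤ ψ → 2 * ψ ≤ 1 →
    lower * ψ ^ m ≤ volume.real (event q ψ)
  volume_inter_le : ∀ {i j q q'}, q ∈ vectors i → q' ∈ vectors j → q ≠ q' → ∀ {ψ ψ' : ℝ},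
    0 ≤ ψ → 0 ≤ ψ' → volume.real (event q ψ ∩ event q' ψ') ≤ upper * ψ ^ m * ψ' ^ m

/-- The primitive vectors with a coordinate larger than `32 ^ j`. -/
def primitiveShell (d j : ℕ) : Finset (Fin d → ℕ) :=
  (primitiveVectors d (32 ^ (j + 1))).filter fun q => ∃ l, 32 ^ j < q l

theorem mem_primitiveShell {j : ℕ} {q : Fin d → ℕ} : q ∈ primitiveShell d j ↔
    ((∀ l, 1 ≤ q l ∧ q l ≤ 32 ^ (j + 1)) ∧ Finset.univ.gcd q = 1) ∧ ∃ l, 32 ^ j < q l := by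
  simp [primitiveShell, primitiveVectors, Fintype.mem_piFinset]

theorem card_primitiveShell_ge (hd : 2 ≤ d) (j : ℕ) :
    1 / 8 * ((32 : ℝ) ^ (j + 1)) ^ d ≤ (primitiveShell d j).card := by
  classical
  have h1 := card_primitiveVectors_ge hd (32 ^ (j + 1))
  have h2 : primitiveVectors d (32 ^ (j + 1)) ⊆ primitiveShell d j ∪
      Fintype.piFinset fun _ => Finset.Icc 1 (32 ^ j) := by
    intro q hq
    by_cases h : ∃ l, 32 ^ j < q l
    · exact Finset.mem_union_left _ (Finset.mem_filter.2 ⟨hq, h⟩)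
    · push Not at h
      refine Finset.mem_union_right _ (Fintype.mem_piFinset.2 fun l => Finset.mem_Icc.2 ⟨?_, h l⟩)
      exact (Finset.mem_Icc.1 (Fintype.mem_piFinset.1 (Finset.mem_filter.1 hq).1 l)).1
  have h3 := (Finset.card_le_card h2).trans (Finset.card_union_le _ _)
  rw [Fintype.card_piFinset] at h3
  simp only [Nat.card_Icc, Nat.add_sub_cancel, Finset.prod_const, Finset.card_univ,
    Fintype.card_fin] at h3
  have h4 : ((primitiveVectors d (32 ^ (j + 1))).card : ℝ)
      ≤ (primitiveShell d j).card + ((32 : ℝ) ^ j) ^ d := by exact_mod_cast h3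
  -- The removed inner box is at most 1/32 of the whole, and 1/4 - 1/32 ≥ 1/8.
  have h5 : ((32 : ℝ) ^ j) ^ d ≤ 1 / 32 * ((32 : ℝ) ^ (j + 1)) ^ d := by
    have h6 : (32 : ℝ) ^ 1 ≤ 32 ^ d := pow_le_pow_right₀ (by norm_num) (by omega)
    have h7 : (0 : ℝ) < ((32 : ℝ) ^ j) ^ d := by positivity
    rw [pow_succ, mul_pow]
    nlinarith
  have h8 : (0 : ℝ) < ((32 : ℝ) ^ (j + 1)) ^ d := by positivity
  push_cast at h1
  linarith

/-- Taking gcds over l in q l₀ * q' l = q' l₀ * q l gives q l₀ = q' l₀, and this common factor then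
cancels. -/
theorem eq_of_primitive_of_parallel {q q' : Fin d → ℕ} (hd : 0 < d) (hpos : ∀ l, 1 ≤ q' l)
    (hq : Finset.univ.gcd q = 1) (hq' : Finset.univ.gcd q' = 1)
    (h : ∀ l l', q l * q' l' = q l' * q' l) : q = q' := by
  set l₀ : Fin d := ⟨0, hd⟩
  have h1 : Finset.univ.gcd (fun l => q l₀ * q' l) = Finset.univ.gcd fun l => q' l₀ * q l :=
    Finset.gcd_congr rfl fun l _ => by rw [h l₀ l, mul_comm]
  rw [Finset.gcd_mul_left, Finset.gcd_mul_left, hq, hq'] at h1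
  have h2 : q l₀ = q' l₀ := by simpa using h1
  ext l
  have h3 := h l l₀
  rw [h2, mul_comm] at h3
  exact Nat.eq_of_mul_eq_mul_left (hpos l₀) h3

/-- The embedding of the vectors of natural numbers into the integer vectors. -/
def natVector (d : ℕ) : (Fin d → ℕ) ↪ (Fin d → ℤ) where
  toFun q l := q l
  inj' q q' h := by
    ext l
    exact Int.ofNat_inj.1 (congrFun h l)

theorem natVector_apply (q : Fin d → ℕ) (l : Fin d) : natVector d q l = q l := rfl

theorem natVector_ne_zero (hd : 0 < d) {q : Fin d → ℕ} (hq : ∀ l, 1 ≤ q l) :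
    natVector d q ≠ 0 := by
  intro h
  have h1 := congrFun h ⟨0, hd⟩
  have h2 := hq ⟨0, hd⟩
  rw [natVector_apply, Pi.zero_apply] at h1
  omega

/-- The family of the primitive vectors, for at least two variables. -/
noncomputable def primitiveFamily (m : ℕ) (hd : 2 ≤ d) : QuasiIndependentFamily m d where
  vectors j := (primitiveShell d j).map (natVector d)
  event q ψ := linearForms q ⁻¹' cube m ψ
  lower := 1 / 8
  upper := 4 ^ m
  lower_pos := by norm_num
  upper_pos := by positivity
  ne_zero := by
    rintro j _ hqm
    obtain ⟨q, hq, rfl⟩ := Finset.mem_map.1 hqm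
    exact natVector_ne_zero (by omega) fun l => ((mem_primitiveShell.1 hq).1.1 l).1
  abs_le := by
    rintro j _ hqm l
    obtain ⟨q, hq, rfl⟩ := Finset.mem_map.1 hqm
    have := (mem_primitiveShell.1 hq).1.1 l
    rw [natVector_apply, Nat.abs_cast]
    exact_mod_cast this.2
  disjoint := by
    intro i j hij
    rw [Finset.disjoint_map, Finset.disjoint_left]
    intro q hq hq'
    obtain ⟨l, hl⟩ := (mem_primitiveShell.1 hq').2
    have := ((mem_primitiveShell.1 hq).1.1 l).2
    have h3 : 32 ^ (i + 1) ≤ 32 ^ j := Nat.pow_le_pow_right (by norm_num) hij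
    omega
  card_ge j := by
    rw [Finset.card_map]
    exact card_primitiveShell_ge hd j
  measurableSet q ψ := ((isOpen_cube ψ).preimage (continuous_linearForms q)).measurableSet
  subset _ _ := subset_rfl
  volume_ge := by
    rintro j _ hqm ψ hψ hψ1
    obtain ⟨q, hq, rfl⟩ := Finset.mem_map.1 hqm
    have h0 := natVector_ne_zero (show 0 < d by omega) fun l => ((mem_primitiveShell.1 hq).1.1 l).1
    rw [volume_real_linearForms_preimage_cube h0 hψ, min_eq_right hψ1,
      mul_pow]
    gcongr
    linarith [one_le_pow₀ (M₀ := ℝ) (n := m) one_le_two]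
  volume_inter_le := by
    rintro i j _ _ hqm hqm' hne ψ ψ' hψ hψ'
    obtain ⟨q, hq, rfl⟩ := Finset.mem_map.1 hqm
    obtain ⟨q', hq', rfl⟩ := Finset.mem_map.1 hqm'
    obtain ⟨l, l', hll⟩ : ∃ l l', q l * q' l' ≠ q l' * q' l := by
      by_contra! hcon
      exact hne (by rw [eq_of_primitive_of_parallel (by omega)
        (fun l => ((mem_primitiveShell.1 hq').1.1 l).1) (mem_primitiveShell.1 hq).1.2
        (mem_primitiveShell.1 hq').1.2 hcon])
    rw [volume_real_linearForms_inter (l := l) (l' := l')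
      (sub_ne_zero.2 (by simp only [natVector_apply]; exact_mod_cast hll)) hψ hψ']
    calc min 1 (2 * ψ) ^ m * min 1 (2 * ψ') ^ m ≤ (2 * ψ) ^ m * (2 * ψ') ^ m := by
          gcongr <;> exact min_le_right _ _
      _ = (2 * 2) ^ m * ψ ^ m * ψ' ^ m := by
          rw [mul_pow, mul_pow, mul_pow]
          ring
      _ = 4 ^ m * ψ ^ m * ψ' ^ m := by norm_num

theorem volume_real_pi_pi (B : Set UnitAddCircle) :
    volume.real (Set.univ.pi fun _ : Fin m => Set.univ.pi fun _ : Fin 1 => B)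
      = volume.real B ^ m := by
  rw [measureReal_def, volume_pi_pi, ENNReal.toReal_prod]
  simp [volume_pi_pi, measureReal_def]

theorem le_of_mem_largeTotient {N q : ℕ} (hq : q ∈ largeTotient N) :
    (1 ≤ q ∧ q ≤ N) ∧ N ≤ 16 * q.totient := by
  simpa [largeTotient] using hq

/-- The embedding of the natural numbers into the integer vectors of length one. -/
def natConst : ℕ ↪ (Fin 1 → ℤ) where
  toFun q _ := q
  inj' _ _ h := Int.ofNat_inj.1 (congrFun h 0)

theorem natConst_apply (q : ℕ) (l : Fin 1) : natConst q l = q := rfl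

/-- The family of the integers with large totient, for one variable. -/
noncomputable def totientFamily (m : ℕ) : QuasiIndependentFamily m 1 where
  vectors j := (largeTotient (32 ^ (j + 1))).map natConst
  -- With one variable all vectors are parallel, so the full sets ‖qα‖ < ψ need not be
  -- quasi-independent. Keeping only the α near fractions of exact denominator q restores the
  -- overlap bound, at the cost of a factor φ(q)/q per row, which is at least 1/16 on the chosen
  -- vectors.
  event q ψ := Set.univ.pi fun _ => Set.univ.pi fun _ => UnitAddCircle.nearOrder (q 0).toNat ψ
  lower := 1 / 16 * (1 / 8) ^ m
  upper := 8 ^ m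
  lower_pos := by positivity
  upper_pos := by positivity
  ne_zero := by
    rintro j _ hqm h
    obtain ⟨q, hq, rfl⟩ := Finset.mem_map.1 hqm
    have := (le_of_mem_largeTotient hq).1.1
    have h2 := congrFun h 0
    rw [natConst_apply, Pi.zero_apply] at h2
    omega
  abs_le := by
    rintro j _ hqm l
    obtain ⟨q, hq, rfl⟩ := Finset.mem_map.1 hqm
    rw [natConst_apply, Nat.abs_cast]
    exact_mod_cast (le_of_mem_largeTotient hq).1.2
  disjoint := by
    intro i j hij
    rw [Finset.disjoint_map, Finset.disjoint_left]
    intro q hq hq'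
    have h1 := (le_of_mem_largeTotient hq).1
    have h2 := (le_of_mem_largeTotient hq').2
    have h3 : 32 ^ (i + 1) ≤ 32 ^ j := Nat.pow_le_pow_right (by norm_num) hij
    -- Here q ≥ φ(q) ≥ 32^(j+1) / 16 = 2 · 32^j, which exceeds every element of the earlier shells.
    -- The ratio 32 is what makes this possible.
    have h4 := Nat.totient_le q
    rw [pow_succ] at h2
    omega
  card_ge j := by
    rw [Finset.card_map]
    have h1 := card_largeTotient_ge (32 ^ (j + 1))
    have h2 : (1 / 8 : ℝ) ^ m ≤ 1 := pow_le_one₀ (by norm_num) (by norm_num)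
    have h3 : (0 : ℝ) < 32 ^ (j + 1) := by positivity
    push_cast at h1
    rw [pow_one]
    nlinarith
  measurableSet q ψ := MeasurableSet.univ_pi fun _ => MeasurableSet.univ_pi fun _ =>
    UnitAddCircle.measurableSet_nearOrder _ _
  subset := by
    rintro j _ hqm ψ α hα i
    obtain ⟨q, hq, rfl⟩ := Finset.mem_map.1 hqm
    have h1 := (le_of_mem_largeTotient hq).1.1
    have h2 := hα i (Set.mem_univ _) 0 (Set.mem_univ _)
    simp only [natConst_apply, Int.toNat_natCast] at h2
    rw [linearForms_apply]
    simpa [natConst_apply] using UnitAddCircle.norm_nsmul_lt_of_mem_nearOrder h1 h2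
  volume_ge := by
    rintro j _ hqm ψ hψ hψ1
    obtain ⟨q, hq, rfl⟩ := Finset.mem_map.1 hqm
    obtain ⟨⟨h1, h2⟩, h3⟩ := le_of_mem_largeTotient hq
    have hq0 : (0 : ℝ) < q := by exact_mod_cast h1
    rw [volume_real_pi_pi]
    simp only [natConst_apply, Int.toNat_natCast]
    rw [UnitAddCircle.volume_real_nearOrder h1 hψ hψ1]
    have h4 : (q : ℝ) ≤ 16 * q.totient := by exact_mod_cast h2.trans h3
    have h5 : 1 / 8 * ψ ≤ q.totient * (2 * (ψ / q)) := by
      have : (q.totient : ℝ) * (2 * (ψ / q)) = 2 * ψ * (q.totient / q) := by ring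
      rw [this]
      have h6 : 1 / 16 ≤ (q.totient : ℝ) / q := by
        rw [div_le_div_iff₀ (by norm_num) hq0]
        linarith
      nlinarith
    calc 1 / 16 * (1 / 8) ^ m * ψ ^ m ≤ 1 * (1 / 8) ^ m * ψ ^ m := by gcongr; norm_num
      _ = (1 / 8 * ψ) ^ m := by rw [mul_pow, one_mul]
      _ ≤ _ := by gcongr
  volume_inter_le := by
    rintro i j _ _ hqm hqm' hne ψ ψ' hψ hψ'
    obtain ⟨q, hq, rfl⟩ := Finset.mem_map.1 hqm
    obtain ⟨q', hq', rfl⟩ := Finset.mem_map.1 hqm'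
    have h1 := (le_of_mem_largeTotient hq).1.1
    have h1' := (le_of_mem_largeTotient hq').1.1
    have h2 : q ≠ q' := fun h => hne (by rw [h])
    rw [← Set.pi_inter_distrib]
    simp_rw [← Set.pi_inter_distrib]
    rw [volume_real_pi_pi]
    simp only [natConst_apply, Int.toNat_natCast]
    rw [← mul_pow, ← mul_pow]
    gcongr
    exact UnitAddCircle.volume_real_nearOrder_inter_le h1 h1' h2 hψ hψ'

theorem nonempty_quasiIndependentFamily (m : ℕ) (hd : 0 < d) :
    Nonempty (QuasiIndependentFamily m d) := by
  rcases Nat.lt_or_ge d 2 with h | h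
  · obtain rfl : d = 1 := by omega
    exact ⟨totientFamily m⟩
  · exact ⟨primitiveFamily m h⟩

end Torus

/-! ### The divergence part of Khinchin–Groshev -/

theorem MeasureTheory.le_measureReal_iInter_of_antitone {Ω : Type*} [MeasurableSpace Ω]
    (μ : Measure Ω) [IsFiniteMeasure μ] {s : ℕ → Set Ω} (hs : ∀ n, MeasurableSet (s n))
    (hanti : Antitone s) {c : ℝ} (hc : ∀ n, c ≤ μ.real (s n)) : c ≤ μ.real (⋂ n, s n) := by
  have h := tendsto_measure_iInter_atTop (μ := μ) (fun n => (hs n).nullMeasurableSet) hanti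
    ⟨0, measure_ne_top _ _⟩
  have h' : Tendsto (fun n => μ.real (s n)) atTop (nhds (μ.real (⋂ n, s n))) :=
    (ENNReal.tendsto_toReal (measure_ne_top _ _)).comp h
  exact ge_of_tendsto' h' hc

namespace Torus

variable {m d : ℕ}

/-- Beyond any J, divergence provides a finite block of events whose measures sum to M ≥ 1/K. The
second-moment inequality then gives its union measure at least M / (1 + K M) ≥ 1 / (2K), and
continuity from above passes to the limsup. The bound is independent of ψ, so it is uniform in the
approximation constant later. -/
theorem QuasiIndependentFamily.le_volume_limsup (F : QuasiIndependentFamily m d) {ψ : ℕ → ℝ}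
    (hψ : ∀ j, 0 ≤ ψ j) (hψ1 : ∀ j, 2 * ψ j ≤ 1)
    (hdiv : ¬ Summable fun j => ((32 : ℝ) ^ (j + 1)) ^ d * ψ j ^ m) :
    F.lower ^ 2 / (2 * F.upper)
      ≤ volume.real (⋂ J, ⋃ j ∈ Set.Ici J, ⋃ q ∈ F.vectors j, F.event q (ψ j)) := by
  have hl := F.lower_pos
  have hu := F.upper_pos
  have hmeas : ∀ J, MeasurableSet (⋃ j ∈ Set.Ici J, ⋃ q ∈ F.vectors j, F.event q (ψ j)) :=
    fun J => MeasurableSet.biUnion (Set.to_countable _) fun j _ =>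
      Finset.measurableSet_biUnion _ fun q _ => F.measurableSet q _
  refine le_measureReal_iInter_of_antitone volume hmeas
    (fun J J' h => Set.biUnion_subset_biUnion_left (Set.Ici_subset_Ici.2 h)) fun J => ?_
  set K := F.upper / F.lower ^ 2 with hK
  have hK0 : 0 < K := by positivity
  set M : ℕ → ℝ := fun n => ∑ p ∈ (Finset.Ico J n).sigma F.vectors,
    volume.real (F.event p.2 (ψ p.1)) with hM
  have hMlower : ∀ n, F.lower ^ 2 * ∑ j ∈ Finset.Ico J n, ((32 : ℝ) ^ (j + 1)) ^ d * ψ j ^ m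
      ≤ M n := by
    intro n
    simp only [hM]
    rw [Finset.sum_sigma, Finset.mul_sum]
    refine Finset.sum_le_sum fun j _ => ?_
    calc F.lower ^ 2 * (((32 : ℝ) ^ (j + 1)) ^ d * ψ j ^ m)
        = (F.lower * ((32 : ℝ) ^ (j + 1)) ^ d) * (F.lower * ψ j ^ m) := by ring
      _ ≤ (F.vectors j).card * (F.lower * ψ j ^ m) := by
          have := hψ j
          gcongr
          exact F.card_ge j
      _ = ∑ _q ∈ F.vectors j, F.lower * ψ j ^ m := by rw [Finset.sum_const, nsmul_eq_mul]
      _ ≤ _ := Finset.sum_le_sum fun q hq => F.volume_ge hq (hψ j) (hψ1 j)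
  obtain ⟨n, hn⟩ : ∃ n, 1 / K ≤ M n := by
    have hdiv' : ¬ Summable fun j => ((32 : ℝ) ^ (j + J + 1)) ^ d * ψ (j + J) ^ m :=
      fun h => hdiv ((summable_nat_add_iff J).1 h)
    have h1 := (not_summable_iff_tendsto_nat_atTop_of_nonneg (fun j => by
      have := hψ (j + J)
      positivity)).1 hdiv'
    obtain ⟨n, hn⟩ := (h1.eventually_ge_atTop (1 / K / F.lower ^ 2)).exists
    refine ⟨J + n, le_trans ?_ (hMlower _)⟩
    rw [Finset.sum_Ico_eq_sum_range, Nat.add_sub_cancel_left, mul_comm,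
      ← div_le_iff₀ (by positivity)]
    refine hn.trans (le_of_eq (Finset.sum_congr rfl fun j _ => ?_))
    rw [add_comm J j]
  have hmain := div_le_measureReal_biUnion volume ((Finset.Ico J n).sigma F.vectors)
    (fun p => F.event p.2 (ψ p.1)) (fun p _ => F.measurableSet _ _) hK0.le (by
      rintro ⟨i, q⟩ hq ⟨j, q'⟩ hq' hne
      rw [Finset.mem_sigma] at hq hq'
      have hne' : q ≠ q' := by
        rintro rfl
        rcases lt_trichotomy i j with h | h | h
        · exact Finset.disjoint_left.1 (F.disjoint h) hq.2 hq'.2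
        · exact hne (by rw [h])
        · exact Finset.disjoint_left.1 (F.disjoint h) hq'.2 hq.2
      have h1 := F.volume_ge hq.2 (hψ i) (hψ1 i)
      have h2 := F.volume_ge hq'.2 (hψ j) (hψ1 j)
      have h3 := hψ i
      have h4 := hψ j
      calc volume.real (F.event q (ψ i) ∩ F.event q' (ψ j))
          ≤ F.upper * ψ i ^ m * ψ j ^ m := F.volume_inter_le hq.2 hq'.2 hne' (hψ i) (hψ j)
        _ = K * (F.lower * ψ i ^ m) * (F.lower * ψ j ^ m) := by
            rw [hK]
            field_simp
        _ ≤ K * volume.real (F.event q (ψ i)) * volume.real (F.event q' (ψ j)) := by gcongr)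
  have hsub : (⋃ p ∈ (Finset.Ico J n).sigma F.vectors, F.event p.2 (ψ p.1))
      ⊆ ⋃ j ∈ Set.Ici J, ⋃ q ∈ F.vectors j, F.event q (ψ j) := by
    refine Set.iUnion₂_subset fun p hp => ?_
    rw [Finset.mem_sigma, Finset.mem_Ico] at hp
    intro x hx
    exact Set.mem_biUnion (show p.1 ∈ Set.Ici J from hp.1.1) (Set.mem_biUnion hp.2 hx)
  refine le_trans ?_ (hmain.trans (measureReal_mono hsub (measure_ne_top _ _)))
  have hMn : 0 < M n := lt_of_lt_of_le (by positivity) hn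
  have e1 : F.lower ^ 2 / (2 * F.upper) = 1 / (2 * K) := by
    rw [hK]
    field_simp
  rw [e1]
  change 1 / (2 * K) ≤ M n / (1 + K * M n)
  rw [div_le_div_iff₀ (by positivity) (by positivity)]
  rw [div_le_iff₀ hK0] at hn
  linarith

/-- The systems admitting approximations of quality `c` with respect to arbitrarily large
parameters `r`. -/
def approximableWith (m d : ℕ) (c : ℝ) : Set (Fin m → Fin d → UnitAddCircle) :=
  {α | ∀ R : ℕ, ∃ r : ℝ, R ≤ r ∧ ∃ q : Fin d → ℤ, q ≠ 0 ∧
    (∀ l, |(q l : ℝ)| ≤ c * r ^ m / Real.log r ^ (1 / (d : ℝ))) ∧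
    linearForms q α ∈ cube m (c / r ^ d)}

theorem measurableSet_approximableWith (c : ℝ) : MeasurableSet (approximableWith m d c) := by
  have : approximableWith m d c = ⋂ R : ℕ, {α | ∃ r : ℝ, R ≤ r ∧ ∃ q : Fin d → ℤ, q ≠ 0 ∧
      (∀ l, |(q l : ℝ)| ≤ c * r ^ m / Real.log r ^ (1 / (d : ℝ))) ∧
      linearForms q α ∈ cube m (c / r ^ d)} := by
    ext
    simp [approximableWith]
  rw [this]
  refine MeasurableSet.iInter fun R => IsOpen.measurableSet ?_
  have : {α : Fin m → Fin d → UnitAddCircle | ∃ r : ℝ, R ≤ r ∧ ∃ q : Fin d → ℤ, q ≠ 0 ∧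
      (∀ l, |(q l : ℝ)| ≤ c * r ^ m / Real.log r ^ (1 / (d : ℝ))) ∧
      linearForms q α ∈ cube m (c / r ^ d)} = ⋃ (r : ℝ) (_ : R ≤ r) (q : Fin d → ℤ) (_ : q ≠ 0)
      (_ : ∀ l, |(q l : ℝ)| ≤ c * r ^ m / Real.log r ^ (1 / (d : ℝ))),
      linearForms q ⁻¹' cube m (c / r ^ d) := by
    ext
    simp only [Set.mem_ofPred_eq, Set.mem_iUnion, Set.mem_preimage, exists_prop]
  rw [this]
  exact isOpen_iUnion fun r => isOpen_iUnion fun _ => isOpen_iUnion fun q => isOpen_iUnion fun _ =>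
    isOpen_iUnion fun _ => (isOpen_cube _).preimage (continuous_linearForms q)

theorem approximableWith_mono {c c' : ℝ} (h : c ≤ c') :
    approximableWith m d c ⊆ approximableWith m d c' := by
  intro α hα R
  -- Taking r ≥ 1 keeps log r nonnegative, so that the bound on q is monotone in c.
  obtain ⟨r, hr, q, hq, hqr, hqα⟩ := hα (max R 1)
  have hr1 : (1 : ℝ) ≤ r := le_trans (by exact_mod_cast le_max_right _ _) hr
  have hlog : 0 ≤ Real.log r := Real.log_nonneg hr1
  refine ⟨r, le_trans (by exact_mod_cast le_max_left _ _) hr, q, hq,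
    fun l => (hqr l).trans ?_, cube_mono ?_ hqα⟩ <;> gcongr

/-- The scales satisfy r_j^m = A^m 32^(j+1) (j+1)^(1/d). Since log r_j is of order j, the admissible
size of q reaches the whole shell 32^(j+1), while the critical series has terms exactly proportional
to 1 / (j + 1). -/
theorem le_volume_approximableWith (hm : 0 < m) (hd : 0 < d) (F : QuasiIndependentFamily m d)
    {c : ℝ} (hc : 0 < c) (hc1 : c ≤ 1 / 2) :
    F.lower ^ 2 / (2 * F.upper) ≤ volume.real (approximableWith m d c) := by
  have hmR : (0 : ℝ) < m := by exact_mod_cast hm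
  have hdR : (0 : ℝ) < d := by exact_mod_cast hd
  -- The 6 matches the bound log r_j ≤ 6 (j + 1): what is needed at the end is c A^m ≥ 6.
  set A : ℝ := 6 / c with hA
  have hA1 : 1 ≤ A := by
    rw [hA, le_div_iff₀ hc]
    linarith
  have hcA : c * A = 6 := by
    rw [hA]
    field_simp
  set x : ℕ → ℝ := fun j => (32 : ℝ) ^ (j + 1) * ((j : ℝ) + 1) ^ (1 / (d : ℝ)) with hx
  have hj1 : ∀ j : ℕ, (1 : ℝ) ≤ (j : ℝ) + 1 := fun j => by
    linarith [(Nat.cast_nonneg j : (0 : ℝ) ≤ j)]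
  have hx32 : ∀ j, (32 : ℝ) ^ (j + 1) ≤ x j := fun j =>
    le_mul_of_one_le_right (by positivity) (Real.one_le_rpow (hj1 j) (by positivity))
  have hx1 : ∀ j, 1 ≤ x j := fun j => (one_le_pow₀ (by norm_num)).trans (hx32 j)
  set r : ℕ → ℝ := fun j => A * x j ^ (1 / (m : ℝ)) with hr
  have hxm1 : ∀ j, 1 ≤ x j ^ (1 / (m : ℝ)) := fun j => Real.one_le_rpow (hx1 j) (by positivity)
  have hrA : ∀ j, A ≤ r j := fun j => le_mul_of_one_le_right (by linarith) (hxm1 j)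
  have hr1 : ∀ j, 1 ≤ r j := fun j => hA1.trans (hrA j)
  have hrm : ∀ j, r j ^ m = A ^ m * x j := by
    intro j
    have := hx1 j
    rw [hr, mul_pow, ← Real.rpow_natCast (x j ^ (1 / (m : ℝ))), ← Real.rpow_mul (by linarith),
      one_div_mul_cancel hmR.ne', Real.rpow_one]
  have hxd : ∀ j, x j ^ d = ((32 : ℝ) ^ (j + 1)) ^ d * ((j : ℝ) + 1) := by
    intro j
    have := hj1 j
    rw [hx, mul_pow, ← Real.rpow_natCast (((j : ℝ) + 1) ^ (1 / (d : ℝ))),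
      ← Real.rpow_mul (by linarith), one_div_mul_cancel hdR.ne', Real.rpow_one]
  have hψ1 : ∀ j, 2 * (c / r j ^ d) ≤ 1 := by
    intro j
    have h1 : c / r j ^ d ≤ c := div_le_self hc.le (one_le_pow₀ (hr1 j))
    linarith
  have hterm : ∀ j, ((32 : ℝ) ^ (j + 1)) ^ d * (c / r j ^ d) ^ m
      = c ^ m / (A ^ m) ^ d * (1 / ((j + 1 : ℕ) : ℝ)) := by
    intro j
    have h1 := hj1 j
    have h2 : (r j ^ d) ^ m = (A ^ m) ^ d * (((32 : ℝ) ^ (j + 1)) ^ d * ((j : ℝ) + 1)) := by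
      rw [← pow_mul, mul_comm, pow_mul, hrm, mul_pow, hxd]
    rw [div_pow, h2]
    push_cast
    have h3 : ((32 : ℝ) ^ (j + 1)) ^ d ≠ 0 := by positivity
    have h4 : (A ^ m) ^ d ≠ 0 := by positivity
    have h5 : (j : ℝ) + 1 ≠ 0 := by linarith
    generalize ((32 : ℝ) ^ (j + 1)) ^ d = y at *
    generalize (A ^ m) ^ d = z at *
    field_simp
  have hdiv : ¬ Summable fun j => ((32 : ℝ) ^ (j + 1)) ^ d * (c / r j ^ d) ^ m := by
    simp_rw [hterm]
    rw [summable_mul_left_iff (by positivity), summable_nat_add_iff 1 (f := fun j : ℕ => 1 / (j : ℝ))]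
    exact Real.not_summable_one_div_natCast
  have hlogr : ∀ᶠ j in atTop, Real.log (r j) ≤ 6 * ((j : ℝ) + 1) := by
    filter_upwards [eventually_ge_atTop ⌈Real.log A⌉₊] with j hj
    have hjA : Real.log A ≤ j := (Nat.le_ceil _).trans (by exact_mod_cast hj)
    have h1 := hj1 j
    have hx0 : 0 < x j := lt_of_lt_of_le one_pos (hx1 j)
    have e1 : Real.log (r j) = Real.log A + 1 / m * Real.log (x j) := by
      rw [hr, Real.log_mul (by linarith) (by positivity), Real.log_rpow hx0]
    have e2 : Real.log (x j) = ((j : ℝ) + 1) * Real.log 32 + 1 / d * Real.log ((j : ℝ) + 1) := by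
      rw [hx, Real.log_mul (by positivity) (by positivity), Real.log_rpow (by linarith), Real.log_pow]
      push_cast
      ring
    have e3 : Real.log 32 ≤ 4 := by
      rw [show (32 : ℝ) = 2 ^ 5 by norm_num, Real.log_pow]
      have := Real.log_two_lt_d9
      push_cast
      linarith
    have e4 : Real.log ((j : ℝ) + 1) ≤ j := by
      have := Real.log_le_sub_one_of_pos (show (0 : ℝ) < (j : ℝ) + 1 by linarith)
      linarith
    have e5 : 1 / (d : ℝ) * Real.log ((j : ℝ) + 1) ≤ j := by
      have h2 : 1 / (d : ℝ) ≤ 1 := by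
        rw [div_le_one hdR]
        exact_mod_cast hd
      have h3 : 0 ≤ Real.log ((j : ℝ) + 1) := Real.log_nonneg h1
      nlinarith
    have e6 : 1 / (m : ℝ) * Real.log (x j) ≤ Real.log (x j) := by
      have h2 : 1 / (m : ℝ) ≤ 1 := by
        rw [div_le_one hmR]
        exact_mod_cast hm
      have h3 : 0 ≤ Real.log (x j) := Real.log_nonneg (hx1 j)
      nlinarith
    nlinarith
  have hrtop : Tendsto r atTop atTop := by
    have h1 : Tendsto x atTop atTop := by
      refine tendsto_atTop_mono hx32 ?_
      exact (tendsto_pow_atTop_atTop_of_one_lt (by norm_num)).comp (tendsto_add_atTop_nat 1)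
    exact Tendsto.const_mul_atTop (by linarith)
      ((tendsto_rpow_atTop (by positivity : (0 : ℝ) < 1 / m)).comp h1)
  refine (F.le_volume_limsup (fun j => by have := hr1 j; positivity) hψ1 hdiv).trans
    (measureReal_mono ?_)
  intro α hα R
  obtain ⟨J, hJ⟩ := eventually_atTop.1 (hlogr.and ((hrtop.eventually_ge_atTop (R : ℝ)).and
    (hrtop.eventually_gt_atTop 1)))
  obtain ⟨j, hj, hjα⟩ := Set.mem_iUnion₂.1 (Set.mem_iInter.1 hα J)
  obtain ⟨q, hq, hqα⟩ := Set.mem_iUnion₂.1 hjα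
  obtain ⟨hlog, hR, hr1'⟩ := hJ j hj
  refine ⟨r j, hR, q, F.ne_zero hq, fun l => ?_, F.subset hq _ hqα⟩
  have hlogpos : 0 < Real.log (r j) := Real.log_pos hr1'
  have h1 : |(q l : ℝ)| ≤ (32 : ℝ) ^ (j + 1) := by exact_mod_cast F.abs_le hq l
  refine h1.trans ?_
  rw [le_div_iff₀ (by positivity), hrm]
  have h2 : Real.log (r j) ^ (1 / (d : ℝ)) ≤ 6 * ((j : ℝ) + 1) ^ (1 / (d : ℝ)) := by
    have := hj1 j
    calc Real.log (r j) ^ (1 / (d : ℝ)) ≤ (6 * ((j : ℝ) + 1)) ^ (1 / (d : ℝ)) := by gcongr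
      _ = 6 ^ (1 / (d : ℝ)) * ((j : ℝ) + 1) ^ (1 / (d : ℝ)) :=
          Real.mul_rpow (by norm_num) (by linarith)
      _ ≤ 6 ^ (1 : ℝ) * ((j : ℝ) + 1) ^ (1 / (d : ℝ)) := by
          gcongr
          · norm_num
          · rw [div_le_one hdR]
            exact_mod_cast hd
      _ = _ := by rw [Real.rpow_one]
  have h3 : 6 ≤ c * A ^ m := by
    rw [← hcA]
    gcongr
    exact le_self_pow₀ hA1 hm.ne'
  calc (32 : ℝ) ^ (j + 1) * Real.log (r j) ^ (1 / (d : ℝ))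
      ≤ (32 : ℝ) ^ (j + 1) * (6 * ((j : ℝ) + 1) ^ (1 / (d : ℝ))) := by gcongr
    _ = 6 * x j := by rw [hx]; ring
    _ ≤ (c * A ^ m) * x j := by
        have := hx1 j
        gcongr
    _ = c * (A ^ m * x j) := by ring

/-- The systems which are approximable with every positive constant. -/
def approximable (m d : ℕ) : Set (Fin m → Fin d → UnitAddCircle) :=
  ⋂ n : ℕ, approximableWith m d (1 / ((n : ℝ) + 2))

theorem mem_approximable {α : Fin m → Fin d → UnitAddCircle} :
    α ∈ approximable m d ↔ ∀ c : ℝ, 0 < c → α ∈ approximableWith m d c := by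
  refine ⟨fun h c hc => ?_, fun h => Set.mem_iInter.2 fun n => h _ (by positivity)⟩
  obtain ⟨n, hn⟩ := exists_nat_one_div_lt hc
  refine approximableWith_mono (le_trans ?_ hn.le) (Set.mem_iInter.1 h n)
  exact one_div_le_one_div_of_le (by positivity) (by linarith)

theorem measurableSet_approximable : MeasurableSet (approximable m d) :=
  MeasurableSet.iInter fun _ => measurableSet_approximableWith _

/-- The lower bound is uniform in c, so it survives the decreasing intersection as c tends to 0. -/
theorem volume_approximable_ne_zero (hm : 0 < m) (hd : 0 < d) : volume (approximable m d) ≠ 0 := by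
  obtain ⟨F⟩ := nonempty_quasiIndependentFamily m hd
  have hl := F.lower_pos
  have hu := F.upper_pos
  have h := le_measureReal_iInter_of_antitone volume
    (s := fun n : ℕ => approximableWith m d (1 / ((n : ℝ) + 2)))
    (fun n => measurableSet_approximableWith _)
    (fun n n' h => approximableWith_mono (one_div_le_one_div_of_le (by positivity)
      (by have : (n : ℝ) ≤ n' := by exact_mod_cast h
          linarith)))
    (fun n => le_volume_approximableWith hm hd F (by positivity)
      (one_div_le_one_div_of_le (by norm_num) (by linarith [(Nat.cast_nonneg n : (0 : ℝ) ≤ n)])))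
  intro h0
  have h1 : volume.real (approximable m d) = 0 := by rw [measureReal_def, h0, ENNReal.toReal_zero]
  have h2 : 0 < F.lower ^ 2 / (2 * F.upper) := by positivity
  exact absurd (h2.trans_le h) (by rw [← approximable, h1]; exact lt_irrefl _)

/-- Replacing q by nq kills the torsion translation and multiplies both the size of q and the error
by n. Starting from the constant c / n absorbs this, which is why membership is required for every
c. -/
theorem add_mem_approximable {n : ℕ} (hn : 0 < n) {g α : Fin m → Fin d → UnitAddCircle}
    (hg : n • g = 0) (hα : α ∈ approximable m d) : g + α ∈ approximable m d := by
  have hnR : (0 : ℝ) < n := by exact_mod_cast hn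
  rw [mem_approximable] at hα ⊢
  intro c hc R
  obtain ⟨r, hr, q, hq, hqr, hqα⟩ := hα (c / n) (by positivity) R
  refine ⟨r, hr, n • q, smul_ne_zero hn.ne' hq, fun l => ?_, fun i => ?_⟩
  · have h1 : |((n • q) l : ℝ)| = n * |(q l : ℝ)| := by simp [abs_mul]
    rw [h1]
    calc n * |(q l : ℝ)| ≤ n * (c / n * r ^ m / Real.log r ^ (1 / (d : ℝ))) := by
          gcongr
          exact hqr l
      _ = _ := by field_simp
  · have h1 : linearForms (n • q) (g + α) = n • linearForms q α := by
      have h2 : ∀ β : Fin m → Fin d → UnitAddCircle, linearForms (n • q) β = n • linearForms q β := by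
        intro β
        ext k
        simp [linearForms_apply, Finset.smul_sum, mul_smul]
      rw [h2, map_add, smul_add, ← map_nsmul, hg, map_zero, zero_add]
    rw [h1, Pi.smul_apply]
    calc ‖n • linearForms q α i‖ ≤ n * ‖linearForms q α i‖ := norm_nsmul_le
      _ < n * (c / n / r ^ d) := by
          gcongr
          exact hqα i
      _ = c / r ^ d := by field_simp

theorem dense_torsion :
    Dense {g : Fin m → Fin d → UnitAddCircle | ∃ n : ℕ, 0 < n ∧ n • g = 0} := by
  intro α
  have hrep : ∀ x : UnitAddCircle, ∃ a : ℝ, 0 ≤ a ∧ (a : UnitAddCircle) = x := by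
    intro x
    obtain ⟨a, ha, rfl⟩ := AddCircle.coe_image_Ico_eq (1 : ℝ) 0 ▸ Set.mem_univ x
    exact ⟨a, ha.1, rfl⟩
  choose a ha hax using fun i j => hrep (α i j)
  have hlim : Tendsto (fun n : ℕ => fun i j => ((⌊a i j * n⌋₊ / n : ℝ) : UnitAddCircle)) atTop
      (nhds α) := by
    refine tendsto_pi_nhds.2 fun i => tendsto_pi_nhds.2 fun j => ?_
    rw [← hax i j]
    exact ((AddCircle.continuous_mk' (1 : ℝ)).tendsto _).comp
      ((tendsto_nat_floor_mul_div_atTop (ha i j)).comp tendsto_natCast_atTop_atTop)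
  refine mem_closure_of_tendsto hlim ?_
  filter_upwards [eventually_gt_atTop 0] with n hn
  refine ⟨n, hn, ?_⟩
  have hnR : (n : ℝ) ≠ 0 := by exact_mod_cast hn.ne'
  ext i j
  simp only [Pi.smul_apply, Pi.zero_apply]
  rw [← AddCircle.coe_nsmul, nsmul_eq_mul, mul_div_cancel₀ _ hnR]
  have := AddCircle.coe_nsmul (1 : ℝ) (n := ⌊a i j * n⌋₊) (x := 1)
  rw [AddCircle.coe_period, smul_zero, nsmul_eq_mul, mul_one] at this
  exact this

/-- The divergence part of the Khinchin–Groshev theorem. -/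
theorem ae_mem_approximable (hm : 0 < m) (hd : 0 < d) :
    ∀ᵐ α : Fin m → Fin d → UnitAddCircle, α ∈ approximable m d := by
  refine ae_mem_of_dense_stabilizer volume measurableSet_approximable.nullMeasurableSet
    (dense_torsion.mono ?_) (volume_approximable_ne_zero hm hd)
  rintro g ⟨n, hn, hg⟩ α
  refine ⟨fun h => ?_, add_mem_approximable hn hg⟩
  have := add_mem_approximable hn (g := -g) (by rw [smul_neg, hg, neg_zero]) h
  rwa [neg_add_cancel_left] at this

end Torus

/-! ### Transfer from the torus to real matrices -/

theorem UnitAddCircle.norm_coe_lt_iff {x η : ℝ} :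
    ‖(x : UnitAddCircle)‖ < η ↔ ∃ p : ℤ, |x - p| < η := by
  rw [UnitAddCircle.norm_eq]
  exact ⟨fun h => ⟨round x, h⟩, fun ⟨p, hp⟩ => (round_le x p).trans_lt hp⟩

namespace Torus

variable {m d : ℕ}

/-- The reduction of a real matrix modulo one. -/
def reduce (α : Fin m → Fin d → ℝ) : Fin m → Fin d → UnitAddCircle := fun i j => α i j

/-- Countably many integer unit boxes cover the space of matrices, and reduction modulo one
preserves measure on each of them. -/
theorem ae_reduce {p : (Fin m → Fin d → UnitAddCircle) → Prop} (hp : ∀ᵐ β, p β) :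
    ∀ᵐ α : Fin m → Fin d → ℝ, p (reduce α) := by
  set box : (Fin m → Fin d → ℤ) → Set (Fin m → Fin d → ℝ) := fun a =>
    Set.univ.pi fun i => Set.univ.pi fun j => Set.Ioc (a i j : ℝ) (a i j + 1) with hbox
  have hcover : ⋃ a, box a = Set.univ := by
    rw [Set.eq_univ_iff_forall]
    intro α
    refine Set.mem_iUnion.2 ⟨fun i j => ⌈α i j⌉ - 1, fun i _ j _ => ?_⟩
    push_cast
    constructor
    · linarith [Int.ceil_lt_add_one (α i j)]
    · linarith [Int.le_ceil (α i j)]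
  have hmp : ∀ a, MeasurePreserving (reduce (m := m) (d := d)) (volume.restrict (box a)) := by
    intro a
    simp only [hbox]
    rw [volume_pi, Measure.restrict_pi_pi]
    simp_rw [volume_pi, Measure.restrict_pi_pi]
    exact measurePreserving_pi _ _ fun i => measurePreserving_pi _ _ fun j =>
      AddCircle.measurePreserving_mk (1 : ℝ) (a i j)
  rw [← Measure.restrict_univ (μ := (volume : Measure (Fin m → Fin d → ℝ))), ← hcover,
    ae_restrict_iUnion_iff]
  exact fun a => (hmp a).quasiMeasurePreserving.ae hp

theorem linearForms_reduce (q : Fin d → ℤ) (α : Fin m → Fin d → ℝ) (i : Fin m) :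
    linearForms q (reduce α) i = ((∑ j, α i j * q j : ℝ) : UnitAddCircle) := by
  have h : ∀ f : Fin d → ℝ, ((∑ j, f j : ℝ) : UnitAddCircle) = ∑ j, (f j : UnitAddCircle) :=
    fun f => map_sum (QuotientAddGroup.mk' (AddSubgroup.zmultiples (1 : ℝ))) f Finset.univ
  rw [linearForms_apply, h]
  refine Finset.sum_congr rfl fun j _ => ?_
  rw [reduce, ← AddCircle.coe_zsmul, zsmul_eq_mul, mul_comm]

theorem norm_linearForms_reduce_sub_lt_iff {q : Fin d → ℤ} {α : Fin m → Fin d → ℝ} {i : Fin m}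
    {x η : ℝ} : ‖linearForms q (reduce α) i - x‖ < η ↔
      ∃ p : ℤ, |∑ j, α i j * q j - p - x| < η := by
  rw [linearForms_reduce, ← AddCircle.coe_sub, UnitAddCircle.norm_coe_lt_iff]
  simp_rw [sub_right_comm]

theorem linearForms_reduce_mem_cube_iff {q : Fin d → ℤ} {α : Fin m → Fin d → ℝ} {η : ℝ} :
    linearForms q (reduce α) ∈ cube m η ↔ ∀ i, ∃ p : ℤ, |∑ j, α i j * q j - p| < η := by
  refine forall_congr' fun i => ?_
  rw [linearForms_reduce, UnitAddCircle.norm_coe_lt_iff]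

/-- The Diophantine properties of a matrix which determine its repulsivity: density of the values
of the linear forms, approximability, and bounds for the gaps and the small values. -/
structure IsGeneric (ε : ℝ) (α : Fin m → Fin d → ℝ) : Prop where
  dense : ∀ η : ℝ, 0 < η → ∀ x : Fin m → ℝ, ∃ n : Fin d → ℤ, ∀ i, ∃ p : ℤ,
    |∑ j, α i j * n j - p - x i| < η
  approximable : ∀ c : ℝ, 0 < c → ∀ R : ℕ, ∃ r : ℝ, R ≤ r ∧ ∃ q : Fin d → ℤ, q ≠ 0 ∧
    (∀ l, |(q l : ℝ)| ≤ c * r ^ m / Real.log r ^ (1 / (d : ℝ))) ∧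
    ∀ i, ∃ p : ℤ, |∑ j, α i j * q j - p| < c / r ^ d
  covered : ∀ᶠ j : ℕ in atTop, ∀ i, ∀ x : ℝ, ∃ n : Fin d → ℤ, (∀ l, |n l| < 2 ^ j) ∧
    ∃ p : ℤ, |∑ l, α i l * n l - p - x| < (j : ℝ) ^ (1 + d * ε / (4 * m)) / 2 ^ (j * d)
  not_small : ∀ᶠ j : ℕ in atTop, ∀ q : Fin d → ℤ, q ≠ 0 →
    (∀ l, |(q l : ℝ)| ≤ 2 ^ (j * m) / (j : ℝ) ^ (1 / (d : ℝ) + m + ε / 2)) →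
    ∃ i, ∀ p : ℤ, 3 * ((j : ℝ) ^ (1 + d * ε / (4 * m)) / 2 ^ (j * d)) ≤ |∑ l, α i l * q l - p|

theorem ae_isGeneric (hm : 0 < m) (hd : 0 < d) {ε : ℝ} (hε : 0 < ε) :
    ∀ᵐ α : Fin m → Fin d → ℝ, IsGeneric ε α := by
  have hmR : (0 : ℝ) < m := by exact_mod_cast hm
  have hdR : (0 : ℝ) < d := by exact_mod_cast hd
  -- The term X^d ψ^m is 3^m times j to the power -(1 + dm - m + dε/4). The ε/2 in X gains dε/2, and
  -- ε₁ in ψ spends half of it, so the exponent exceeds 1 even when d = 1.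
  set ε₁ : ℝ := d * ε / (4 * m) with hε₁
  have hε₁0 : 0 < ε₁ := by positivity
  set X : ℕ → ℝ := fun j => 2 ^ (j * m) / (j : ℝ) ^ (1 / (d : ℝ) + m + ε / 2) with hX
  set ψ : ℕ → ℝ := fun j => 3 * ((j : ℝ) ^ (1 + ε₁) / 2 ^ (j * d)) with hψ
  have hsum : Summable fun j => X j ^ d * ψ j ^ m := by
    have h1 : Summable fun j : ℕ => 3 ^ m * (1 / (j : ℝ) ^ (1 + d * m - m + d * ε / 4)) := by
      refine (Real.summable_one_div_nat_rpow.2 ?_).mul_left _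
      have : (1 : ℝ) ≤ d := by exact_mod_cast hd
      have : 0 < d * ε := by positivity
      nlinarith
    refine h1.of_norm_bounded_eventually_nat ?_
    filter_upwards [eventually_gt_atTop 0] with j hj
    have hj0 : (0 : ℝ) < j := by exact_mod_cast hj
    rw [Real.norm_of_nonneg (by positivity)]
    refine le_of_eq ?_
    simp only [hX, hψ]
    rw [div_pow, mul_pow, div_pow, ← pow_mul, ← pow_mul, ← Real.rpow_natCast ((j : ℝ) ^ _),
      ← Real.rpow_natCast ((j : ℝ) ^ _), ← Real.rpow_mul hj0.le, ← Real.rpow_mul hj0.le,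
      show j * d * m = j * m * d by ring]
    have e1 : (1 / (d : ℝ) + m + ε / 2) * d = (1 + ε₁) * m + (1 + d * m - m + d * ε / 4) := by
      rw [hε₁]
      field_simp
      ring
    rw [e1, Real.rpow_add hj0]
    field_simp
  have h1 := ae_reduce (ae_dense_linearForms (m := m) hd)
  have h2 := ae_reduce (ae_mem_approximable hm hd)
  have h3 := ae_reduce (ae_eventually_covered (m := m) hd hε₁0)
  have h4 := ae_reduce (ae_eventually_notMem_cube (m := m) (X := X) (ψ := ψ)
    (fun j => by positivity) (fun j => by positivity) hsum)
  filter_upwards [h1, h2, h3, h4] with α h1 h2 h3 h4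
  refine ⟨fun η hη x => ?_, fun c hc R => ?_, ?_, ?_⟩
  · obtain ⟨n, hn⟩ := h1 η hη fun i => (x i : UnitAddCircle)
    exact ⟨n, fun i => norm_linearForms_reduce_sub_lt_iff.1 (hn i)⟩
  · obtain ⟨r, hr, q, hq, hqr, hqα⟩ := mem_approximable.1 h2 c hc R
    exact ⟨r, hr, q, hq, hqr, linearForms_reduce_mem_cube_iff.1 hqα⟩
  · filter_upwards [h3] with j hj i x
    obtain ⟨n, hn, hnx⟩ := hj i (x : UnitAddCircle)
    exact ⟨n, hn, norm_linearForms_reduce_sub_lt_iff.1 hnx⟩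
  · filter_upwards [h4] with j hj q hq hqX
    have h5 := hj q hq hqX
    rw [linearForms_reduce_mem_cube_iff] at h5
    push Not at h5
    exact h5

end Torus

/-! ### Heights, patches and distances in the cut and project set -/

namespace CutProject

variable {d m : ℕ} {α : Fin m → Fin d → ℝ}

/-- The coordinates of a point modulo the physical space. -/
def transverse (α : Fin m → Fin d → ℝ) : TotalSpace d m →ₗ[ℝ] (Fin m → ℝ) where
  toFun v i := v (Sum.inr i) - ∑ j, α i j * v (Sum.inl j)
  map_add' v w := by
    ext i
    simp only [PiLp.add_apply, mul_add, Finset.sum_add_distrib, Pi.add_apply]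
    ring
  map_smul' t v := by
    ext i
    simp only [PiLp.smul_apply, smul_eq_mul, RingHom.id_apply, Pi.smul_apply, mul_sub,
      Finset.mul_sum, mul_left_comm]

theorem transverse_apply (v : TotalSpace d m) (i : Fin m) :
    transverse α v i = v (Sum.inr i) - ∑ j, α i j * v (Sum.inl j) := rfl

theorem mem_physicalSpace_iff {v : TotalSpace d m} : v ∈ physicalSpace α ↔ transverse α v = 0 := by
  rw [funext_iff]
  exact forall_congr' fun i => by rw [transverse_apply, Pi.zero_apply, sub_eq_zero]

/-- The point with first coordinates `x` and last coordinates `y`. -/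
def point (x : Fin d → ℝ) (y : Fin m → ℝ) : TotalSpace d m := WithLp.toLp 2 (Sum.elim x y)

@[simp]
theorem point_inl (x : Fin d → ℝ) (y : Fin m → ℝ) (j : Fin d) : point x y (Sum.inl j) = x j := rfl

@[simp]
theorem point_inr (x : Fin d → ℝ) (y : Fin m → ℝ) (i : Fin m) : point x y (Sum.inr i) = y i := rfl

theorem point_sub (x x' : Fin d → ℝ) (y y' : Fin m → ℝ) :
    point x y - point x' y' = point (x - x') (y - y') := by
  ext (j | i) <;> simp

theorem transverse_point_zero (y : Fin m → ℝ) : transverse α (point 0 y) = y := by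
  ext i
  simp [transverse_apply]

/-- The lattice point with coordinates `n` and `b`. -/
def latticePoint (n : Fin d → ℤ) (b : Fin m → ℤ) : TotalSpace d m :=
  point (fun j => n j) (fun i => b i)

theorem latticePoint_mem (n : Fin d → ℤ) (b : Fin m → ℤ) :
    latticePoint n b ∈ integerLattice d m := by
  rintro (j | i)
  · exact ⟨n j, rfl⟩
  · exact ⟨b i, rfl⟩

theorem mem_integerLattice_iff {z : TotalSpace d m} :
    z ∈ integerLattice d m ↔ ∃ n b, z = latticePoint n b := by
  refine ⟨fun h => ?_, ?_⟩
  · choose f hf using h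
    refine ⟨fun j => f (Sum.inl j), fun i => f (Sum.inr i), ?_⟩
    ext (j | i) <;> simp [latticePoint, hf]
  · rintro ⟨n, b, rfl⟩
    exact latticePoint_mem n b

theorem latticePoint_sub (n n' : Fin d → ℤ) (b b' : Fin m → ℤ) :
    latticePoint n b - latticePoint n' b' = latticePoint (n - n') (b - b') := by
  rw [latticePoint, latticePoint, point_sub, latticePoint]
  congr 1 <;> ext <;> simp

theorem latticePoint_injective {n n' : Fin d → ℤ} {b b' : Fin m → ℤ}
    (h : latticePoint n b = latticePoint n' b') : n = n' ∧ b = b' := by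
  constructor
  · ext j
    have := congrArg (fun v : TotalSpace d m => v (Sum.inl j)) h
    simpa [latticePoint] using this
  · ext i
    have := congrArg (fun v : TotalSpace d m => v (Sum.inr i)) h
    simpa [latticePoint] using this

theorem transverse_latticePoint (n : Fin d → ℤ) (b : Fin m → ℤ) (i : Fin m) :
    transverse α (latticePoint n b) i = b i - ∑ j, α i j * n j := rfl

namespace CubicalScheme

variable (C : CubicalScheme α)

theorem transverse_projStar (v : TotalSpace d m) :
    transverse α (C.projStar v) = transverse α v := by
  have h : C.proj v + C.projStar v = v := Submodule.projection_add_projection_eq_self C.isCompl v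
  have h2 : transverse α (C.proj v) = 0 :=
    mem_physicalSpace_iff.1 (Submodule.projection_apply_mem C.isCompl v)
  nth_rw 2 [← h]
  rw [map_add, h2, zero_add]

theorem projStar_eq_of_transverse_eq {v w : TotalSpace d m}
    (h : transverse α v = transverse α w) : C.projStar v = C.projStar w := by
  rw [← sub_eq_zero, ← map_sub]
  refine (Submodule.projection_apply_eq_zero_iff C.isCompl.symm).2 (mem_physicalSpace_iff.2 ?_)
  rw [map_sub, h, sub_self]

/-- `projStar` moves points only along E, the kernel of `transverse`, so the internal space drops
out of the description of the slice. -/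
theorem mem_slice_iff {v : TotalSpace d m} :
    v ∈ C.slice ↔ ∀ i, transverse α v i ∈ Set.Icc (0 : ℝ) 1 := by
  constructor
  · rintro ⟨w, ⟨f, hf, rfl⟩, e, he, rfl⟩ i
    rw [SetLike.mem_coe, mem_physicalSpace_iff] at he
    rw [map_add, he, add_zero, C.transverse_projStar]
    simpa [transverse_apply, hf.1] using hf.2 i
  · intro h
    refine ⟨C.projStar v, ⟨point 0 (transverse α v), ⟨fun j => rfl, h⟩, ?_⟩, C.proj v,
      Submodule.projection_apply_mem C.isCompl v, ?_⟩
    · exact C.projStar_eq_of_transverse_eq (transverse_point_zero _)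
    · change C.projStar v + C.proj v = v
      rw [add_comm]
      exact Submodule.projection_add_projection_eq_self C.isCompl v

theorem mem_frontier_slice {v : TotalSpace d m} (hv : v ∈ C.slice) {i : Fin m}
    (hi : transverse α v i = 0 ∨ transverse α v i = 1) : v ∈ frontier C.slice := by
  refine ⟨subset_closure hv, fun hint => ?_⟩
  have key : ∀ t : ℝ, (∀ᶠ x in nhdsWithin (0 : ℝ) (Set.Ioi 0), transverse α v i + x * t ∉ Set.Icc (0 : ℝ) 1) →
      False := by
    intro t ht
    have hcont : Tendsto (fun x : ℝ => v + x • point 0 (Pi.single i t)) (nhdsWithin 0 (Set.Ioi 0))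
        (nhds v) := by
      have : Continuous fun x : ℝ => v + x • (point 0 (Pi.single i t) : TotalSpace d m) := by
        fun_prop
      have h2 := this.tendsto 0
      rw [zero_smul, add_zero] at h2
      exact h2.mono_left nhdsWithin_le_nhds
    have h3 := hcont.eventually (mem_interior_iff_mem_nhds.1 hint)
    obtain ⟨x, hx, hx'⟩ := (h3.and ht).exists
    refine hx' ?_
    have h4 := C.mem_slice_iff.1 hx i
    rwa [map_add, map_smul, transverse_point_zero, Pi.add_apply, Pi.smul_apply,
      Pi.single_eq_same, smul_eq_mul] at h4
  rcases hi with hi | hi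
  · refine key (-1) ?_
    filter_upwards [self_mem_nhdsWithin] with x hx h
    have h1 : 0 < x := hx
    rw [hi] at h
    linarith [h.1]
  · refine key 1 ?_
    filter_upwards [self_mem_nhdsWithin] with x hx h
    have h1 : 0 < x := hx
    rw [hi] at h
    linarith [h.2]

theorem transverse_mem_Ioo {s : TotalSpace d m} (hreg : C.IsRegular s) {x : TotalSpace d m}
    (hx : x ∈ C.slice) (hxs : x ∈ shiftedLattice s) (i : Fin m) :
    transverse α x i ∈ Set.Ioo (0 : ℝ) 1 := by
  have h := C.mem_slice_iff.1 hx i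
  have hnot : x ∉ frontier C.slice := fun hf => by
    have : x ∈ frontier C.slice ∩ shiftedLattice s := ⟨hf, hxs⟩
    rw [hreg] at this
    exact this
  refine ⟨lt_of_le_of_ne h.1 fun h0 => ?_, lt_of_le_of_ne h.2 fun h1 => ?_⟩
  · exact hnot (C.mem_frontier_slice hx (Or.inl h0.symm))
  · exact hnot (C.mem_frontier_slice hx (Or.inr h1))

/-- The function `b` gives the last coordinates of the unique point of the slice over each vector
of first coordinates. -/
structure IsHeight (s : TotalSpace d m) (b : (Fin d → ℤ) → Fin m → ℤ) : Prop where
  transverse_mem : ∀ n i, transverse α (latticePoint n (b n) + s) i ∈ Set.Ioo (0 : ℝ) 1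
  slice_inter : C.slice ∩ shiftedLattice s = Set.range fun n => latticePoint n (b n) + s

theorem exists_isHeight {s : TotalSpace d m} (hreg : C.IsRegular s) : ∃ b, C.IsHeight s b := by
  have hex : ∀ n : Fin d → ℤ, ∃ b : Fin m → ℤ,
      ∀ i, transverse α (latticePoint n b + s) i ∈ Set.Icc (0 : ℝ) 1 := by
    intro n
    -- Rounding up puts each transverse coordinate in [0, 1). Regularity then excludes the
    -- endpoints, which also makes the height unique.
    refine ⟨fun i => ⌈(∑ j, α i j * n j) - transverse α s i⌉, fun i => ?_⟩
    rw [map_add, Pi.add_apply, transverse_latticePoint]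
    constructor
    · linarith [Int.le_ceil ((∑ j, α i j * n j) - transverse α s i)]
    · linarith [Int.ceil_lt_add_one ((∑ j, α i j * n j) - transverse α s i)]
  choose b hb using hex
  have hmem : ∀ n b', latticePoint n b' + s ∈ shiftedLattice s := fun n b' =>
    ⟨_, latticePoint_mem n b', rfl⟩
  have hIoo : ∀ n i, transverse α (latticePoint n (b n) + s) i ∈ Set.Ioo (0 : ℝ) 1 := fun n i =>
    C.transverse_mem_Ioo hreg (C.mem_slice_iff.2 (hb n)) (hmem n _) i
  refine ⟨b, hIoo, Set.Subset.antisymm ?_ ?_⟩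
  · rintro x ⟨hx, hxs⟩
    have hxIoo := C.transverse_mem_Ioo hreg hx hxs
    obtain ⟨z, hz, rfl⟩ := hxs
    obtain ⟨n, b', rfl⟩ := mem_integerLattice_iff.1 hz
    refine ⟨n, ?_⟩
    have : b n = b' := by
      ext i
      have h1 := hIoo n i
      have h2 := hxIoo i
      rw [map_add, Pi.add_apply, transverse_latticePoint] at h1 h2
      have h3 : ((b n i - b' i : ℤ) : ℝ) < 1 := by push_cast; linarith [h1.2, h2.1]
      have h4 : (-1 : ℝ) < ((b n i - b' i : ℤ) : ℝ) := by push_cast; linarith [h1.1, h2.2]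
      have h5 : b n i - b' i < 1 := by exact_mod_cast h3
      have h6 : -1 < b n i - b' i := by exact_mod_cast h4
      omega
    simp only [this]
  · rintro _ ⟨n, rfl⟩
    exact ⟨C.mem_slice_iff.2 (hb n), hmem n _⟩

variable {C} {s : TotalSpace d m} {b : (Fin d → ℤ) → Fin m → ℤ}

namespace IsHeight

theorem cutProjectSet_eq (hb : C.IsHeight s b) :
    C.cutProjectSet s = Set.range fun n => C.proj (latticePoint n (b n) + s) := by
  rw [cutProjectSet, hb.slice_inter, ← Set.range_comp]
  rfl

theorem proj_latticePoint_eq_iff {n n' : Fin d → ℤ} {c c' : Fin m → ℤ} :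
    C.proj (latticePoint n c) = C.proj (latticePoint n' c') ↔ n = n' ∧ c = c' := by
  refine ⟨fun h => latticePoint_injective (C.injOn (latticePoint_mem _ _) (latticePoint_mem _ _) h),
    ?_⟩
  rintro ⟨rfl, rfl⟩
  rfl

theorem proj_injective : Function.Injective fun n => C.proj (latticePoint n (b n) + s) := by
  intro n n' h
  simp only [map_add, add_left_inj] at h
  exact (proj_latticePoint_eq_iff.1 h).1

theorem isLift_iff {n : Fin d → ℤ} {c : Fin m → ℤ} {x : TotalSpace d m} :
    C.IsLift s x (C.proj (latticePoint n c + s)) ↔ x = latticePoint n c + s := by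
  constructor
  · rintro ⟨⟨z, hz, rfl⟩, hx⟩
    rw [map_add, map_add, add_left_inj] at hx
    rw [C.injOn hz (latticePoint_mem n c) hx]
  · rintro rfl
    exact ⟨⟨_, latticePoint_mem _ _, rfl⟩, rfl⟩

theorem mem_patch_iff (hb : C.IsHeight s b) {n : Fin d → ℤ} {r : ℝ} {y : TotalSpace d m} :
    y ∈ C.patch s (C.proj (latticePoint n (b n) + s)) r ↔ ∃ h : Fin d → ℤ,
      (∀ j, |(h j : ℝ)| ≤ r) ∧ y = C.proj (latticePoint (n + h) (b (n + h)) + s) := by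
  constructor
  · rintro ⟨hy, x, x', hx, hx', hxx⟩
    rw [hb.cutProjectSet_eq] at hy
    obtain ⟨n', rfl⟩ := hy
    rw [isLift_iff] at hx hx'
    subst hx hx'
    refine ⟨n' - n, fun j => ?_, by rw [add_sub_cancel]⟩
    have := hxx.2 j
    rw [add_sub_add_right_eq_sub, latticePoint_sub] at this
    rw [abs_le]
    exact this
  · rintro ⟨h, hr, rfl⟩
    refine ⟨by rw [hb.cutProjectSet_eq]; exact ⟨n + h, rfl⟩, _, _, isLift_iff.2 rfl,
      isLift_iff.2 rfl, ?_⟩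
    rw [add_sub_add_right_eq_sub, latticePoint_sub, add_sub_cancel_left]
    exact ⟨latticePoint_mem _ _, fun j => abs_le.1 (hr j)⟩

theorem image_patch_eq (hb : C.IsHeight s b) (n : Fin d → ℤ) (r : ℝ) :
    (fun z => z - C.proj (latticePoint n (b n) + s)) ''
        C.patch s (C.proj (latticePoint n (b n) + s)) r
      = (fun h : Fin d → ℤ => C.proj (latticePoint h (b (n + h) - b n))) ''
        {h | ∀ j, |(h j : ℝ)| ≤ r} := by
  have key : ∀ h : Fin d → ℤ, C.proj (latticePoint (n + h) (b (n + h)) + s)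
      - C.proj (latticePoint n (b n) + s) = C.proj (latticePoint h (b (n + h) - b n)) := by
    intro h
    rw [← map_sub, add_sub_add_right_eq_sub, latticePoint_sub, add_sub_cancel_left]
  ext y
  constructor
  · rintro ⟨z, hz, rfl⟩
    obtain ⟨h, hr, rfl⟩ := hb.mem_patch_iff.1 hz
    exact ⟨h, hr, (key h).symm⟩
  · rintro ⟨h, hr, rfl⟩
    exact ⟨_, hb.mem_patch_iff.2 ⟨h, hr, rfl⟩, key h⟩

/-- `proj` is injective on the lattice, so a point of a recentred patch determines both h and the
height increment over it. -/
theorem patchEquiv_iff (hb : C.IsHeight s b) {n n' : Fin d → ℤ} {r : ℝ} :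
    C.PatchEquiv s r (C.proj (latticePoint n (b n) + s)) (C.proj (latticePoint n' (b n') + s)) ↔
      ∀ h : Fin d → ℤ, (∀ j, |(h j : ℝ)| ≤ r) → b (n + h) - b n = b (n' + h) - b n' := by
  rw [PatchEquiv, hb.image_patch_eq, hb.image_patch_eq]
  constructor
  · intro heq h hr
    have h1 : C.proj (latticePoint h (b (n + h) - b n)) ∈
        (fun h : Fin d → ℤ => C.proj (latticePoint h (b (n' + h) - b n'))) ''
        {h | ∀ j, |(h j : ℝ)| ≤ r} := by
      rw [← heq]
      exact ⟨h, hr, rfl⟩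
    obtain ⟨h', hr', e⟩ := h1
    obtain ⟨rfl, e2⟩ := proj_latticePoint_eq_iff.1 e
    exact e2.symm
  · intro h
    exact Set.image_congr fun k hk => by rw [h k hk]

theorem transverse_sub_lt (hb : C.IsHeight s b) (n n' : Fin d → ℤ) (i : Fin m) :
    |transverse α (latticePoint (n - n') (b n - b n')) i| < 1 := by
  have h1 := hb.transverse_mem n i
  have h2 := hb.transverse_mem n' i
  rw [map_add, Pi.add_apply] at h1 h2
  rw [← latticePoint_sub, map_sub, Pi.sub_apply, abs_lt]
  constructor <;> linarith [h1.1, h1.2, h2.1, h2.2]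

end IsHeight

theorem norm_le_of_forall_abs_le {v : TotalSpace d m} {Y : ℝ} (hY : 0 ≤ Y) (h : ∀ k, |v k| ≤ Y) :
    ‖v‖ ≤ (d + m) * Y := by
  rw [EuclideanSpace.norm_eq, Real.sqrt_le_iff]
  refine ⟨by positivity, ?_⟩
  calc ∑ k, ‖v k‖ ^ 2 ≤ ∑ _k : Fin d ⊕ Fin m, Y ^ 2 :=
        Finset.sum_le_sum fun k _ => by
          rw [Real.norm_eq_abs]
          gcongr
          exact h k
    _ = (d + m) * Y ^ 2 := by simp
    _ ≤ ((d + m) * Y) ^ 2 := by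
        rw [mul_pow]
        gcongr
        exact_mod_cast Nat.le_self_pow two_ne_zero (d + m)

namespace IsHeight

/-- The lattice difference z is `proj z + projStar z`. The second term depends only on the
transverse part, which lies in (-1,1)^m, so it is bounded uniformly. -/
theorem exists_abs_sub_le_dist_add (hb : C.IsHeight s b) : ∃ B : ℝ, ∀ n n' : Fin d → ℤ, ∀ j,
    |(n j : ℝ) - n' j| ≤ dist (C.proj (latticePoint n (b n) + s))
      (C.proj (latticePoint n' (b n') + s)) + B := by
  set T := LinearMap.toContinuousLinearMap C.projStar with hT
  refine ⟨‖T‖ * ((d + m) * 1), fun n n' j => ?_⟩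
  set z := latticePoint (n - n') (b n - b n') with hz
  have hdist : dist (C.proj (latticePoint n (b n) + s)) (C.proj (latticePoint n' (b n') + s))
      = ‖C.proj z‖ := by
    rw [dist_eq_norm, ← map_sub, add_sub_add_right_eq_sub, latticePoint_sub]
  have hzsum : C.proj z + C.projStar z = z :=
    Submodule.projection_add_projection_eq_self C.isCompl z
  have hstar : C.projStar z = T (point 0 (transverse α z)) :=
    C.projStar_eq_of_transverse_eq (transverse_point_zero _).symm
  have hpoint : ‖(point 0 (transverse α z) : TotalSpace d m)‖ ≤ (d + m) * 1 := by
    refine norm_le_of_forall_abs_le zero_le_one ?_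
    rintro (k | k)
    · simp
    · rw [point_inr]
      exact (hb.transverse_sub_lt n n' k).le
  calc |(n j : ℝ) - n' j| = ‖z (Sum.inl j)‖ := by
        rw [Real.norm_eq_abs, hz, latticePoint, point_inl, Pi.sub_apply, Int.cast_sub]
    _ ≤ ‖z‖ := PiLp.norm_apply_le z _
    _ = ‖C.proj z + C.projStar z‖ := by rw [hzsum]
    _ ≤ ‖C.proj z‖ + ‖C.projStar z‖ := norm_add_le _ _
    _ ≤ _ := by
        rw [hdist, hstar]
        gcongr
        exact (T.le_opNorm _).trans (by gcongr)

theorem exists_dist_le (hb : C.IsHeight s b) : ∃ A : ℝ, 0 < A ∧ ∀ n n' : Fin d → ℤ, ∀ X : ℝ, 0 ≤ X →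
    (∀ j, |(n j : ℝ) - n' j| ≤ X) → dist (C.proj (latticePoint n (b n) + s))
      (C.proj (latticePoint n' (b n') + s)) ≤ A * (X + 1) := by
  set T := LinearMap.toContinuousLinearMap C.proj with hT
  set a : ℝ := ∑ i, ∑ j, |α i j| with ha
  have ha0 : 0 ≤ a := by positivity
  refine ⟨(‖T‖ + 1) * ((d + m + 1) * (a + 1)), by positivity, fun n n' X hX hn => ?_⟩
  set z := latticePoint (n - n') (b n - b n') with hz
  have hdist : dist (C.proj (latticePoint n (b n) + s)) (C.proj (latticePoint n' (b n') + s))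
      = ‖T z‖ := by
    rw [dist_eq_norm, ← map_sub, add_sub_add_right_eq_sub, latticePoint_sub]
    rfl
  have hinl : ∀ j, |z (Sum.inl j)| ≤ X := fun j => by
    rw [hz, latticePoint, point_inl, Pi.sub_apply, Int.cast_sub]
    exact hn j
  have hcoord : ∀ k, |z k| ≤ (a + 1) * (X + 1) := by
    rintro (j | i)
    · refine (hinl j).trans ?_
      nlinarith
    · have h1 := hb.transverse_sub_lt n n' i
      rw [transverse_apply] at h1
      have h2 : |∑ j, α i j * z (Sum.inl j)| ≤ a * X := by
        calc |∑ j, α i j * z (Sum.inl j)| ≤ ∑ j, |α i j * z (Sum.inl j)| :=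
              Finset.abs_sum_le_sum_abs _ _
          _ ≤ ∑ j, |α i j| * X := Finset.sum_le_sum fun j _ => by
              rw [abs_mul]
              gcongr
              exact hinl j
          _ = (∑ j, |α i j|) * X := by rw [Finset.sum_mul]
          _ ≤ a * X := by
              gcongr
              exact Finset.single_le_sum (f := fun i => ∑ j, |α i j|)
                (fun i _ => by positivity) (Finset.mem_univ i)
      have h3 := abs_sub_abs_le_abs_sub (z (Sum.inr i)) (∑ j, α i j * z (Sum.inl j))
      nlinarith
  rw [hdist]
  calc ‖T z‖ ≤ ‖T‖ * ‖z‖ := T.le_opNorm z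
    _ ≤ (‖T‖ + 1) * ((d + m + 1) * ((a + 1) * (X + 1))) := by
        have h1 := norm_le_of_forall_abs_le (by positivity) hcoord
        gcongr
        · linarith
        · have h2 : 0 ≤ (a + 1) * (X + 1) := by positivity
          linarith
    _ = _ := by ring

end IsHeight

end CubicalScheme

end CutProject

/-! ### Separation by values of linear forms, and gaps between them -/

/-- Pigeonhole: M points cannot meet all of the M + 1 equal open subintervals of [0, 1]. -/
theorem Finset.exists_gap_of_card (S : Finset ℝ) : ∃ u v : ℝ, 0 ≤ u ∧ v ≤ 1 ∧
    v - u = 1 / ((S.card : ℝ) + 1) ∧ ∀ x ∈ S, ¬ (u < x ∧ x < v) := by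
  set M := S.card with hM
  have hM1 : (0 : ℝ) < (M : ℝ) + 1 := by positivity
  by_contra! hcon
  have h : ∀ k : Fin (M + 1), ∃ x ∈ S, (k : ℝ) / ((M : ℝ) + 1) < x ∧ x < ((k : ℝ) + 1) / ((M : ℝ) + 1) := by
    intro k
    refine hcon _ _ (by positivity) ?_ (by ring)
    rw [div_le_one hM1]
    have : (k : ℕ) ≤ M := Nat.lt_succ_iff.1 k.2
    have : ((k : ℕ) : ℝ) ≤ M := by exact_mod_cast this
    linarith
  choose f hfS hf1 hf2 using h
  have hinj : Function.Injective f := by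
    have key : ∀ k k' : Fin (M + 1), f k = f k' → (k : ℕ) ≤ k' := by
      intro k k' hkk
      have h1 := (hf1 k).trans_le hkk.le
      have h2 := h1.trans (hf2 k')
      rw [div_lt_div_iff_of_pos_right hM1] at h2
      have : (k : ℕ) < k' + 1 := by exact_mod_cast h2
      omega
    exact fun k k' hkk => Fin.ext (le_antisymm (key k k' hkk) (key k' k hkk.symm))
  have := Finset.card_le_card_of_injOn (s := Finset.univ) f (fun k _ => hfS k) hinj.injOn
  rw [Finset.card_univ, Fintype.card_fin] at this
  omega

theorem Int.cast_eq_of_mem_Ioo {x y : ℝ} (hx : x ∈ Set.Ioo (0 : ℝ) 1) (hy : y ∈ Set.Ioo (0 : ℝ) 1)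
    {p : ℤ} (h : x = y + p) : x = y := by
  have h1 : (p : ℝ) < 1 := by linarith [hx.2, hy.1]
  have h2 : (-1 : ℝ) < p := by linarith [hx.1, hy.2]
  have h3 : p < 1 := by exact_mod_cast h1
  have h4 : -1 < p := by exact_mod_cast h2
  obtain rfl : p = 0 := by omega
  simpa using h

namespace CutProject.CubicalScheme

variable {d m : ℕ} {α : Fin m → Fin d → ℝ} {C : CubicalScheme α} {s : TotalSpace d m}
  {b : (Fin d → ℤ) → Fin m → ℤ}

namespace IsHeight

theorem transverse_eq (n : Fin d → ℤ) (i : Fin m) :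
    transverse α (latticePoint n (b n) + s) i
      = b n i - ∑ j, α i j * n j + transverse α s i := by
  rw [map_add, Pi.add_apply, transverse_latticePoint]

/-- As the left side lies in (0,1), the height increment is the only integer returning w(n) - L(h)
to that interval. Hence w(n) alone determines the patch. -/
theorem transverse_add_eq (n h : Fin d → ℤ) (i : Fin m) :
    transverse α (latticePoint (n + h) (b (n + h)) + s) i
      = transverse α (latticePoint n (b n) + s) i + ((b (n + h) - b n) i : ℤ)
        - ∑ j, α i j * h j := by
  rw [transverse_eq, transverse_eq]
  simp only [Pi.add_apply, Pi.sub_apply, Int.cast_add, Int.cast_sub, mul_add,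
    Finset.sum_add_distrib]
  ring

/-- The first inequality forces the common increment above p, the second below p + 1. -/
theorem not_separated (hb : C.IsHeight s b) {n n' h : Fin d → ℤ} {i : Fin m} {p : ℤ}
    (heq : (b (n + h) - b n) i = (b (n' + h) - b n') i)
    (h1 : transverse α (latticePoint n (b n) + s) i < ∑ j, α i j * h j - p)
    (h2 : ∑ j, α i j * h j - p < transverse α (latticePoint n' (b n') + s) i) : False := by
  have h3 := hb.transverse_mem (n + h) i
  have h4 := hb.transverse_mem (n' + h) i
  rw [transverse_add_eq] at h3 h4
  rw [heq] at h3
  have h5 : (p : ℝ) < ((b (n' + h) - b n') i : ℤ) := by linarith [h3.1]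
  have h6 : (((b (n' + h) - b n') i : ℤ) : ℝ) < (p : ℝ) + 1 := by linarith [h4.2]
  have h7 : p < (b (n' + h) - b n') i := by exact_mod_cast h5
  have h8 : (b (n' + h) - b n') i < p + 1 := by exact_mod_cast h6
  omega

theorem abs_transverse_sub_le (hb : C.IsHeight s b) {n n' : Fin d → ℤ} {i : Fin m} {r δ : ℝ}
    (heq : ∀ h : Fin d → ℤ, (∀ j, |(h j : ℝ)| ≤ r) → b (n + h) - b n = b (n' + h) - b n')
    (hcov : ∀ x : ℝ, ∃ h : Fin d → ℤ, (∀ j, |(h j : ℝ)| ≤ r) ∧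
      ∃ p : ℤ, |∑ j, α i j * h j - p - x| < δ) :
    transverse α (latticePoint n (b n) + s) i - transverse α (latticePoint n' (b n') + s) i
      ≤ 2 * δ := by
  by_contra! hlt
  -- A value within δ of the midpoint separates two points more than 2δ apart.
  obtain ⟨h, hr, p, hp⟩ := hcov ((transverse α (latticePoint n (b n) + s) i
    + transverse α (latticePoint n' (b n') + s) i) / 2)
  rw [abs_lt] at hp
  refine hb.not_separated (n := n') (n' := n) (h := h) (p := p) (congrFun (heq h hr).symm i) ?_ ?_
  · linarith [hp.1]
  · linarith [hp.2]

theorem le_of_mem_gap (hb : C.IsHeight s b) {n n' h : Fin d → ℤ} {i : Fin m} {u v : ℝ}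
    (hgap : ∀ p : ℤ, ¬ (u < ∑ j, α i j * h j - p ∧ ∑ j, α i j * h j - p < v))
    (hn : transverse α (latticePoint n (b n) + s) i ∈ Set.Ioo u v)
    (hn' : transverse α (latticePoint n' (b n') + s) i ∈ Set.Ioo u v) :
    (b (n + h) - b n) i ≤ (b (n' + h) - b n') i := by
  by_contra! hlt
  have h3 := hb.transverse_mem (n + h) i
  have h4 := hb.transverse_mem (n' + h) i
  rw [transverse_add_eq] at h3 h4
  have h5 : (((b (n' + h) - b n') i : ℤ) : ℝ) + 1 ≤ ((b (n + h) - b n) i : ℤ) := by exact_mod_cast hlt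
  -- If the increments differ, the translate of the form's value by the smaller one lies between the
  -- two transverse coordinates, hence in the gap.
  refine hgap ((b (n' + h) - b n') i) ⟨?_, ?_⟩
  · linarith [h3.2, hn.1]
  · linarith [h4.1, hn'.2]

theorem sub_eq_of_mem_gap (hb : C.IsHeight s b) {n n' h : Fin d → ℤ} {u v : Fin m → ℝ}
    (hgap : ∀ i, ∀ p : ℤ, ¬ (u i < ∑ j, α i j * h j - p ∧ ∑ j, α i j * h j - p < v i))
    (hn : ∀ i, transverse α (latticePoint n (b n) + s) i ∈ Set.Ioo (u i) (v i))
    (hn' : ∀ i, transverse α (latticePoint n' (b n') + s) i ∈ Set.Ioo (u i) (v i)) :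
    b (n + h) - b n = b (n' + h) - b n' :=
  funext fun i => le_antisymm (hb.le_of_mem_gap (hgap i) (hn i) (hn' i))
    (hb.le_of_mem_gap (hgap i) (hn' i) (hn i))

end IsHeight

/-- Each linear form leaves a gap of length about `r ^ (-d)` at the integer points of size `r`. -/
theorem exists_gap (a : Fin d → ℝ) {r : ℝ} (hr : 1 ≤ r) :
    ∃ u v : ℝ, 0 ≤ u ∧ v ≤ 1 ∧ 1 / (2 * 3 ^ d) / r ^ d ≤ v - u ∧ ∀ h : Fin d → ℤ,
      (∀ j, |(h j : ℝ)| ≤ r) → ∀ p : ℤ, ¬ (u < ∑ j, a j * h j - p ∧ ∑ j, a j * h j - p < v) := by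
  classical
  set B : Finset (Fin d → ℤ) := Fintype.piFinset fun _ => Finset.Icc (-⌊r⌋) ⌊r⌋ with hB
  have hfl : (0 : ℤ) ≤ ⌊r⌋ := Int.floor_nonneg.2 (by linarith)
  have hBcard : (B.card : ℝ) ≤ (3 * r) ^ d := by
    have h1 : B.card = (2 * ⌊r⌋ + 1).toNat ^ d := by
      rw [hB, Fintype.card_piFinset]
      simp only [Int.card_Icc, Finset.prod_const, Finset.card_univ, Fintype.card_fin]
      congr 2
      ring
    rw [h1, Nat.cast_pow]
    have h2 : (((2 * ⌊r⌋ + 1).toNat : ℕ) : ℝ) = 2 * (⌊r⌋ : ℝ) + 1 := by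
      have : (((2 * ⌊r⌋ + 1).toNat : ℤ) : ℝ) = ((2 * ⌊r⌋ + 1 : ℤ) : ℝ) := by
        rw [Int.toNat_of_nonneg (by omega)]
      push_cast at this
      exact this
    rw [h2]
    have h0 : (0 : ℝ) ≤ ⌊r⌋ := by exact_mod_cast hfl
    gcongr
    linarith [Int.floor_le r]
  set S := B.image fun h => Int.fract (∑ j, a j * h j) with hS
  obtain ⟨u, v, hu, hv, huv, hgap⟩ := S.exists_gap_of_card
  refine ⟨u, v, hu, hv, ?_, fun h hr p hp => ?_⟩
  · rw [huv, div_div]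
    refine one_div_le_one_div_of_le (by positivity) ?_
    have h1 : (S.card : ℝ) ≤ (3 * r) ^ d :=
      le_trans (by exact_mod_cast Finset.card_image_le) hBcard
    have h2 : (1 : ℝ) ≤ (3 * r) ^ d := one_le_pow₀ (by linarith)
    calc (S.card : ℝ) + 1 ≤ 2 * (3 * r) ^ d := by linarith
      _ = 2 * 3 ^ d * r ^ d := by rw [mul_pow]; ring
  -- Because the gap lies inside [0, 1], a translate falling in it must be the fractional part.
  · have hfr : Int.fract (∑ j, a j * h j) = ∑ j, a j * h j - p := by
      rw [Int.fract_eq_iff]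
      exact ⟨by linarith [hp.1], by linarith [hp.2], p, by ring⟩
    refine hgap _ (Finset.mem_image_of_mem _ (Fintype.mem_piFinset.2 fun j => ?_)) (hfr ▸ hp)
    have := abs_le.1 (hr j)
    rw [Finset.mem_Icc]
    refine ⟨?_, Int.le_floor.2 this.2⟩
    rw [neg_le]
    refine Int.le_floor.2 ?_
    push_cast
    linarith [this.1]

/-! ### Failure of repulsivity, repulsivity, and the conclusion -/

theorem not_isRepulsive {ε : ℝ} (hα : Torus.IsGeneric ε α) (hreg : C.IsRegular s)
    {c : ℝ} (hc : 0 < c) {φ : ℝ → ℝ}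
    (hφ : ∀ᶠ r : ℝ in atTop, c * r ^ m / Real.log r ^ (1 / (d : ℝ)) ≤ φ r) :
    ¬ C.IsRepulsive s φ := by
  intro hrep
  obtain ⟨b, hb⟩ := C.exists_isHeight hreg
  obtain ⟨A, hA, hdist⟩ := hb.exists_dist_le
  obtain ⟨R, hR⟩ := eventually_atTop.1 (hφ.and (hrep.and (eventually_ge_atTop (1 : ℝ))))
  set g : ℝ := 1 / (2 * 3 ^ d) with hg
  have hg0 : 0 < g := by positivity
  -- The first bound makes the distance A (X + 1) ≤ 2AX at most c r^m / (log r)^(1/d); the second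
  -- makes the displacement θ shorter than the gap.
  set c₀ : ℝ := min (c / (2 * A)) (g / 2) with hc₀
  have hc₀0 : 0 < c₀ := by positivity
  have hc₀g : c₀ < g := (min_le_right _ _).trans_lt (by linarith)
  obtain ⟨r, hrR, q, hq, hqr, hqα⟩ := hα.approximable c₀ hc₀0 ⌈R⌉₊
  obtain ⟨hφr, hrepr, hr1⟩ := hR r ((Nat.le_ceil R).trans hrR)
  have hr0 : 0 < r := by linarith
  choose p hp using hqα
  choose u v hu hv huv hgap using fun i => exists_gap (α i) hr1
  set η : ℝ := (g / r ^ d - c₀ / r ^ d) / 2 with hη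
  have hη0 : 0 < η := by
    have : c₀ / r ^ d < g / r ^ d := by gcongr
    linarith
  set θ : Fin m → ℝ := fun i => ∑ j, α i j * q j - p i with hθ
  -- The target for w(n) is (u + v + θ)/2, so w(n + q) = w(n) - θ is near (u + v - θ)/2. The two
  -- targets are symmetric about the middle of the gap, and η is half the slack between the gap
  -- length and the bound on |θ|.
  obtain ⟨n, hn⟩ := hα.dense η hη0 fun i => transverse α s i - (u i + v i + θ i) / 2
  choose p' hp' using hn
  have hw : ∀ i, |transverse α (latticePoint n (b n) + s) i - (u i + v i + θ i) / 2| < η := by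
    intro i
    have h1 := hp' i
    have h2 := abs_lt.1 (hp i)
    have h3 := huv i
    rw [abs_lt] at h1
    have h4 : transverse α (latticePoint n (b n) + s) i
        = transverse α s i - ∑ j, α i j * n j + p' i := by
      refine Int.cast_eq_of_mem_Ioo (hb.transverse_mem n i) ⟨?_, ?_⟩ (p := b n i - p' i) ?_
      · linarith [h1.2, h2.1, hu i]
      · linarith [h1.1, h2.2, hv i]
      · rw [IsHeight.transverse_eq]
        push_cast
        ring
    rw [h4, abs_lt]
    constructor <;> linarith [h1.1, h1.2]
  have hwq : ∀ i, transverse α (latticePoint (n + q) (b (n + q)) + s) i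
      = transverse α (latticePoint n (b n) + s) i - θ i := by
    intro i
    have h1 := abs_lt.1 (hw i)
    have h2 := abs_lt.1 (hp i)
    have h3 := huv i
    refine Int.cast_eq_of_mem_Ioo (hb.transverse_mem _ i) ⟨?_, ?_⟩
      (p := (b (n + q) - b n) i - p i) ?_
    · simp only [hθ] at h1 ⊢
      linarith [h1.1, h2.2, hu i]
    · simp only [hθ] at h1 ⊢
      linarith [h1.2, h2.1, hv i]
    · rw [IsHeight.transverse_add_eq]
      push_cast
      ring
  have hequiv : C.PatchEquiv s r (C.proj (latticePoint n (b n) + s))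
      (C.proj (latticePoint (n + q) (b (n + q)) + s)) := by
    rw [hb.patchEquiv_iff]
    intro h hh
    refine hb.sub_eq_of_mem_gap (fun i => hgap i h hh) (fun i => ?_) (fun i => ?_)
    · have h1 := abs_lt.1 (hw i)
      have h2 := abs_lt.1 (hp i)
      have h3 := huv i
      simp only [hθ] at h1
      constructor <;> linarith [h1.1, h1.2, h2.1, h2.2]
    · have h1 := abs_lt.1 (hw i)
      have h2 := abs_lt.1 (hp i)
      have h3 := huv i
      rw [hwq i]
      simp only [hθ] at h1 ⊢
      constructor <;> linarith [h1.1, h1.2, h2.1, h2.2]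
  have hmem : ∀ n, C.proj (latticePoint n (b n) + s) ∈ C.cutProjectSet s := fun n => by
    rw [hb.cutProjectSet_eq]
    exact ⟨n, rfl⟩
  have hne : C.proj (latticePoint n (b n) + s) ≠ C.proj (latticePoint (n + q) (b (n + q)) + s) := by
    intro h
    have := IsHeight.proj_injective h
    exact hq (by simpa using this)
  have hlt := hrepr _ (hmem n) _ (hmem (n + q)) hne hequiv
  set X := c₀ * r ^ m / Real.log r ^ (1 / (d : ℝ)) with hX
  -- A nonzero integer vector has a coordinate of size at least 1, so X + 1 ≤ 2X absorbs the
  -- additive constant.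
  have hX1 : 1 ≤ X := by
    obtain ⟨l, hl⟩ := Function.ne_iff.1 hq
    have h1 : (1 : ℤ) ≤ |q l| := Int.one_le_abs hl
    have h2 : (1 : ℝ) ≤ |(q l : ℝ)| := by exact_mod_cast h1
    exact h2.trans (hqr l)
  have hle := hdist n (n + q) X (by linarith) fun j => by
    rw [Pi.add_apply, Int.cast_add, sub_add_cancel_left, abs_neg]
    exact hqr j
  have hfin : A * (X + 1) ≤ φ r := by
    refine le_trans ?_ hφr
    calc A * (X + 1) ≤ A * (X + X) := by gcongr
      _ = (2 * A * c₀) * r ^ m / Real.log r ^ (1 / (d : ℝ)) := by rw [hX]; ring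
      _ ≤ c * r ^ m / Real.log r ^ (1 / (d : ℝ)) := by
          have hlog : 0 ≤ Real.log r := Real.log_nonneg hr1
          gcongr
          calc 2 * A * c₀ ≤ 2 * A * (c / (2 * A)) := by
                gcongr
                exact min_le_left _ _
            _ = c := by field_simp
  linarith

/-- This replaces r in [2^j, 2^(j+1)) by its dyadic scale. The spare factor j^ε absorbs the
multiplicative constants, and the exponential growth absorbs B. -/
theorem eventually_dyadic_le (hm : 0 < m) {c ε : ℝ} (hc : 0 < c) (hε : 0 < ε) (e B : ℝ) :
    ∀ᶠ j : ℕ in atTop, c * ((2 : ℝ) ^ (j + 1)) ^ m / (j * Real.log 2) ^ (e + ε) + B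
      ≤ 2 ^ (j * m) / (j : ℝ) ^ e := by
  have hlog2 : 0 < Real.log 2 := Real.log_pos one_lt_two
  set K : ℝ := c * 2 ^ m / Real.log 2 ^ (e + ε) with hK
  have hK0 : 0 < K := by positivity
  have h1 : Tendsto (fun j : ℕ => (j : ℝ) ^ ε) atTop atTop :=
    (tendsto_rpow_atTop hε).comp tendsto_natCast_atTop_atTop
  have h2 : Tendsto (fun x : ℝ => x ^ e * Real.exp (-Real.log 2 * x)) atTop (nhds 0) :=
    tendsto_rpow_mul_exp_neg_mul_atTop_nhds_zero _ _ hlog2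
  have h3 := ((h2.comp tendsto_natCast_atTop_atTop).const_mul |B|)
  rw [mul_zero] at h3
  filter_upwards [h1.eventually_ge_atTop (2 * K), h3.eventually_le_const (show (0 : ℝ) < 1 / 2 by norm_num),
    eventually_gt_atTop 0] with j hj1 hj2 hj0
  have hjR : (0 : ℝ) < j := by exact_mod_cast hj0
  have hje : (0 : ℝ) < (j : ℝ) ^ e := by positivity
  have hjε : (0 : ℝ) < (j : ℝ) ^ ε := by positivity
  have hP : (0 : ℝ) < 2 ^ (j * m) := by positivity
  have e1 : c * ((2 : ℝ) ^ (j + 1)) ^ m / (j * Real.log 2) ^ (e + ε)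
      = (K / (j : ℝ) ^ ε) * (2 ^ (j * m) / (j : ℝ) ^ e) := by
    rw [hK, Real.mul_rpow hjR.le hlog2.le, Real.rpow_add hjR, pow_succ, mul_pow, ← pow_mul]
    field_simp
  have e2 : K / (j : ℝ) ^ ε ≤ 1 / 2 := by
    rw [div_le_div_iff₀ hjε two_pos]
    linarith
  have e3 : B ≤ 1 / 2 * (2 ^ (j * m) / (j : ℝ) ^ e) := by
    simp only [Function.comp] at hj2
    have e4 : Real.exp (-Real.log 2 * j) = (2 ^ j)⁻¹ := by
      rw [neg_mul, Real.exp_neg, mul_comm (Real.log 2), Real.exp_nat_mul, Real.exp_log two_pos]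
    rw [e4] at hj2
    have e5 : (2 : ℝ) ^ j ≤ 2 ^ (j * m) :=
      pow_le_pow_right₀ one_le_two (Nat.le_mul_of_pos_right j hm)
    have e6 : |B| * (j : ℝ) ^ e ≤ 1 / 2 * 2 ^ j := by
      have : |B| * ((j : ℝ) ^ e * (2 ^ j)⁻¹) = |B| * (j : ℝ) ^ e / 2 ^ j := by
        rw [div_eq_mul_inv]
        ring
      rwa [this, div_le_iff₀ (by positivity)] at hj2
    rw [← mul_div_assoc, le_div_iff₀ hje]
    calc B * (j : ℝ) ^ e ≤ |B| * (j : ℝ) ^ e := by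
          gcongr
          exact le_abs_self B
      _ ≤ 1 / 2 * 2 ^ j := e6
      _ ≤ _ := by gcongr
  rw [e1]
  have e7 : (K / (j : ℝ) ^ ε) * (2 ^ (j * m) / (j : ℝ) ^ e) ≤ 1 / 2 * (2 ^ (j * m) / (j : ℝ) ^ e) := by
    gcongr
  linarith

theorem isRepulsive (hm : 0 < m) (hd : 0 < d) {ε : ℝ} (hε : 0 < ε) (hα : Torus.IsGeneric ε α)
    (hreg : C.IsRegular s) {c : ℝ} (hc : 0 < c) {φ : ℝ → ℝ}
    (hφ : ∀ᶠ r : ℝ in atTop, φ r ≤ c * r ^ m / Real.log r ^ (1 / (d : ℝ) + m + ε)) :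
    C.IsRepulsive s φ := by
  have hmR : (0 : ℝ) < m := by exact_mod_cast hm
  obtain ⟨b, hb⟩ := C.exists_isHeight hreg
  obtain ⟨B, hB⟩ := hb.exists_abs_sub_le_dist_add
  set e : ℝ := 1 / (d : ℝ) + m + ε / 2 with he
  have he0 : 0 < e := by positivity
  have hlog2 : 0 < Real.log 2 := Real.log_pos one_lt_two
  obtain ⟨J, hJ⟩ := eventually_atTop.1 (hα.covered.and (hα.not_small.and
    ((eventually_dyadic_le hm hc (half_pos hε) e B).and (eventually_gt_atTop 0))))
  filter_upwards [hφ, eventually_ge_atTop ((2 : ℝ) ^ J), eventually_ge_atTop (1 : ℝ)]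
    with r hφr hrJ hr1
  obtain ⟨j, hj1, hj2⟩ := exists_nat_pow_near hr1 (one_lt_two (α := ℝ))
  have hJj : J ≤ j := by
    have h1 : (2 : ℝ) ^ J < 2 ^ (j + 1) := hrJ.trans_lt hj2
    have := (pow_lt_pow_iff_right₀ (one_lt_two (α := ℝ))).1 h1
    omega
  obtain ⟨hcov, hsmall, hsize, hj0⟩ := hJ j hJj
  have hjR : (0 : ℝ) < j := by exact_mod_cast hj0
  intro y hy y' hy' hne hequiv
  rw [hb.cutProjectSet_eq] at hy hy'
  obtain ⟨n, rfl⟩ := hy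
  obtain ⟨n', rfl⟩ := hy'
  simp only at hne hequiv ⊢
  by_contra! hle
  have hnn : n - n' ≠ 0 := fun h => hne (by rw [sub_eq_zero.1 h])
  have hφX : φ r + B ≤ 2 ^ (j * m) / (j : ℝ) ^ e := by
    refine le_trans ?_ hsize
    gcongr
    refine hφr.trans ?_
    have h1 : j * Real.log 2 ≤ Real.log r := by
      rw [← Real.log_pow]
      exact Real.log_le_log (by positivity) hj1
    have h2 : 1 / (d : ℝ) + m + ε = e + ε / 2 := by
      rw [he]
      ring
    rw [h2]
    gcongr
  -- Some coordinate of L(n - n') stays at least 3δ from all integers, whereas equal patches bring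
  -- the transverse coordinates within 2δ. The two differ only by an integer, which is the
  -- contradiction.
  obtain ⟨i, hi⟩ := hsmall (n - n') hnn fun l => by
    rw [Pi.sub_apply, Int.cast_sub]
    exact (hB n n' l).trans (by linarith)
  set δ : ℝ := (j : ℝ) ^ (1 + d * ε / (4 * m)) / 2 ^ (j * d) with hδ
  have hδ0 : 0 < δ := by positivity
  have hcov' : ∀ x : ℝ, ∃ h : Fin d → ℤ, (∀ l, |(h l : ℝ)| ≤ r) ∧
      ∃ p : ℤ, |∑ l, α i l * h l - p - x| < δ := by
    intro x
    obtain ⟨h, hh, hp⟩ := hcov i x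
    refine ⟨h, fun l => le_trans ?_ hj1, hp⟩
    exact_mod_cast (hh l).le
  rw [hb.patchEquiv_iff] at hequiv
  have h1 := hb.abs_transverse_sub_le hequiv hcov'
  have h2 := hb.abs_transverse_sub_le (fun h hr => (hequiv h hr).symm) hcov'
  have h3 := hi (b n i - b n' i)
  have h4 : ∑ l, α i l * ((n - n') l : ℤ) - ((b n i - b n' i : ℤ) : ℝ)
      = transverse α (latticePoint n' (b n') + s) i - transverse α (latticePoint n (b n) + s) i := by
    rw [IsHeight.transverse_eq, IsHeight.transverse_eq]
    simp only [Pi.sub_apply, Int.cast_sub, mul_sub, Finset.sum_sub_distrib]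
    ring
  rw [h4] at h3
  have h5 : |transverse α (latticePoint n' (b n') + s) i
      - transverse α (latticePoint n (b n) + s) i| ≤ 2 * δ := abs_le.2 ⟨by linarith, h2⟩
  linarith

end CutProject.CubicalScheme

theorem theorem3 {k d : ℕ} (hd : 0 < d) (hdk : d < k) (c ε : ℝ) (hc : 0 < c) (hε : 0 < ε) :
    ∀ᵐ α : Fin (k - d) → Fin d → ℝ,
      ∀ (C : CutProject.CubicalScheme α) (s : CutProject.TotalSpace d (k - d)),
        C.IsRegular s →
        (∀ φ : ℝ → ℝ,
          (∀ᶠ r : ℝ in atTop,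
            c * r ^ ((k : ℝ) - d) / Real.log r ^ (1 / (d : ℝ)) ≤ φ r) →
          ¬ C.IsRepulsive s φ) ∧
        (∀ φ : ℝ → ℝ,
          (∀ᶠ r : ℝ in atTop,
            φ r ≤ c * r ^ ((k : ℝ) - d) /
              Real.log r ^ (1 / (d : ℝ) + ((k : ℝ) - d) + ε)) →
          C.IsRepulsive s φ) := by
  have hm : 0 < k - d := Nat.sub_pos_of_lt hdk
  have hcast : (k : ℝ) - d = ((k - d : ℕ) : ℝ) := (Nat.cast_sub hdk.le).symm
  filter_upwards [Torus.ae_isGeneric hm hd hε] with α hα C s hreg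
  simp_rw [hcast, Real.rpow_natCast]
  exact ⟨fun φ hφ => CutProject.CubicalScheme.not_isRepulsive hα hreg hc hφ,
    fun φ hφ => CutProject.CubicalScheme.isRepulsive hm hd hε hα hreg hc hφ⟩
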